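/- Let $\Gamma_1$ be the graph obtained from an equilateral triangle by joining the midpoints of its sides ($6$ vertices, $9$ edges). Its edges are labelled by $a,b,c$ as follows: going around the boundary of the big triangle counterclockwise from the lower left corner, the six boundary edges are labelled $a,b,a,b,a,b$, and the three edges of the central triangle are labelled $c$. For $n\ge 1$, let $\Gamma_{n+1}$ be the labelled graph obtained by partitioning an equilateral triangle into four smaller equilateral triangles and putting a (translated) copy of $\Gamma_n$ in each of the three corner triangles, so that any two copies share exactly one outmost vertex (the Sierpiński graphs with the rotation-invariant labelling). For $n\ge 1$ and $w\in\{a,b,c\}$ let $w_n$ be the number of edges labelled $w$ in a uniformly random spanning tree of $\Gamma_n$, and let $\mu_{n,w}$ and $\sigma^2_{n,w}$ be the mean and the variance of $w_n$. 1. For every $n\ge 1$, $$\mu_{n,a}=\mu_{n,b}=\frac{16\cdot 3^n+7}{30},\qquad \mu_{n,c}=\frac{13\cdot 3^n+1}{30},$$ $$\sigma^2_{n,a}=\sigma^2_{n,b}=\frac{199\cdot 3^n+28}{900},\qquad \sigma^2_{n,c}=\frac{34\cdot 3^n-2}{225}.$$ 2. The random variables $a_n,b_n,c_n$ are asymptotically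 normal as $n\to\infty$: for each $w\in\{a,b,c\}$ the normalized variable $W_n=(w_n-\mu_{n,w})/\sigma_{n,w}$ satisfies $$\lim_{n\to\infty}\mathbb{E}\bigl(e^{tW_n}\bigr)=e^{t^2/2}\ \text{ for every } t\in\mathbb{R},\qquad \lim_{n\to\infty}\mathbb{P}(W_n\le x)=\frac1{\sqrt{2\pi}}\int_{-\infty}^x e^{-u^2/2}\,du\ \text{ for every } x\in\mathbb{R}.$$ -/

import Mathlib

open MeasureTheory ProbabilityTheory Filter Topology

/-- The three edge labels. -/
inductive EdgeLabel
  | a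
  | b
  | c
  deriving DecidableEq

namespace Sierpinski

/-- Points of the triangular lattice: `(x, y)` is the point `x • (1, 0) + y • (1/2, √3/2)`. -/
abbrev Pt : Type := ℕ × ℕ

/-- Translation of an edge by a lattice vector. -/
def shiftEdge (v : Pt) (e : Sym2 Pt) : Sym2 Pt := e.map (fun p => p + v)

/-- The vertices of `Γ_n`, `n ≥ 1`. The outmost vertices of `Γ_n` are `(0, 0)` (left),
`(2 ^ n, 0)` (right), `(0, 2 ^ n)` (top); the three corner copies of `Γ_n` in `Γ_{n+1}` are its
translates by `(0, 0)`, `(2 ^ n, 0)`, `(0, 2 ^ n)`. The value at `n = 0` is a placeholder. -/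
def verts : ℕ → Finset Pt
  | 0 => ∅
  | 1 => {(0, 0), (1, 0), (2, 0), (0, 1), (1, 1), (0, 2)}
  | n + 2 => verts (n + 1)
      ∪ (verts (n + 1)).image (fun p => p + (2 ^ (n + 1), 0))
      ∪ (verts (n + 1)).image (fun p => p + (0, 2 ^ (n + 1)))

/-- The edges of `Γ_1` with a given label: on each side of the big triangle one half is labelled
`a` and the other half `b`, in a way invariant under the rotation by `2π/3`; the edges of the
central triangle are labelled `c`. -/
def baseEdges : EdgeLabel → Finset (Sym2 Pt)
  | .a => {s((0, 0), (1, 0)), s((2, 0), (1, 1)), s((0, 2), (0, 1))}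
  | .b => {s((1, 0), (2, 0)), s((1, 1), (0, 2)), s((0, 1), (0, 0))}
  | .c => {s((1, 0), (1, 1)), s((1, 1), (0, 1)), s((0, 1), (1, 0))}

/-- The edges of `Γ_n` with a given label, `n ≥ 1` (the value at `n = 0` is a placeholder). -/
def labelledEdges (w : EdgeLabel) : ℕ → Finset (Sym2 Pt)
  | 0 => ∅
  | 1 => baseEdges w
  | n + 2 => labelledEdges w (n + 1)
      ∪ (labelledEdges w (n + 1)).image (shiftEdge (2 ^ (n + 1), 0))
      ∪ (labelledEdges w (n + 1)).image (shiftEdge (0, 2 ^ (n + 1)))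

/-- All edges of `Γ_n`. -/
def edges (n : ℕ) : Finset (Sym2 Pt) :=
  labelledEdges .a n ∪ labelledEdges .b n ∪ labelledEdges .c n

/-- The graph with vertex set that of `Γ_n` and with edge set `t`. -/
def spanningSubgraph (n : ℕ) (t : Finset (Sym2 Pt)) : SimpleGraph (verts n) :=
  (SimpleGraph.fromEdgeSet (t : Set (Sym2 Pt))).induce (verts n : Set Pt)

/-- The spanning trees of `Γ_n`, each given by its set of edges. -/
def spanningTrees (n : ℕ) : Set (Finset (Sym2 Pt)) :=
  {t | t ⊆ edges n ∧ (spanningSubgraph n t).IsTree}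

/-- The law of a uniformly random spanning tree of `Γ_n`. -/
noncomputable def ust (n : ℕ) : Measure (Finset (Sym2 Pt)) := uniformOn (spanningTrees n)

/-- The number of edges of `Γ_n` labelled `w` in the tree `t`, as a real random variable. -/
def labelCount (n : ℕ) (w : EdgeLabel) (t : Finset (Sym2 Pt)) : ℝ :=
  ((t ∩ labelledEdges w n).card : ℝ)

/-- The mean of the number of `w`-edges. -/
noncomputable def meanCount (n : ℕ) (w : EdgeLabel) : ℝ := ∫ t, labelCount n w t ∂(ust n)

/-- The variance of the number of `w`-edges. -/
noncomputable def varCount (n : ℕ) (w : EdgeLabel) : ℝ := Var[labelCount n w; ust n]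

/-- The number of `w`-edges, centred by its mean and divided by its standard deviation. -/
noncomputable def normalizedCount (n : ℕ) (w : EdgeLabel) (t : Finset (Sym2 Pt)) : ℝ :=
  (labelCount n w t - meanCount n w) / √(varCount n w)

end Sierpinski

/-! For one label, give its edges weight `X` and all other edges weight `1`. Three polynomials
describe `Γ_n` seen from its outmost vertices: `T` counts spanning trees, `F` counts two-component
spanning forests isolating a prescribed outmost vertex (the same polynomial for each of the three,
by rotation invariance), and `S` counts three-component forests separating all three. Cutting
`Γ_{n+1}` into its three copies of `Γ_n` expresses each of its polynomials as a sum of products of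
three polynomials of `Γ_n` (`IsGlue.hasType_iff`, `forestSum_triEdges_succ`).

Rotation invariance also makes the network electrically equivalent to a triangle with equal
conductances, which suggests `T * S = 3 * F ^ 2`. The identity is checked for `Γ_1` and is preserved
by gluing. It collapses the recursion to `T' = 6 T² F`, `F' = 10 T F²`, hence up to a positive
constant the tree polynomial of `Γ_{m+1}` is `T₁^(k+1) F₁^k` with `2k+1 = 3^m` (`labelSum_eq`).

Up to constants, `T₁` and `F₁` are products of the factors `2X+1`, `X+1`, `X+4`, `3X+2`. Each is a
multiple of the generating function of a Bernoulli variable with parameter `2/3`, `1/2`, `1/5`,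
`3/5`. So the label count has the law of a sum of independent Bernoulli variables
(`sum_treeFinset_eq`); its mean and variance are read off, and a second order expansion of the
cumulant generating function at complex arguments gives both limits: real arguments for the moment
generating function, imaginary ones for the characteristic function and thus, by Lévy's theorem, for
the distribution function. -/

namespace Sierpinski

/-! ### Spanning forests and their boundary partitions, described by two-colourings constant on
components. -/

section Boundary

variable {α : Type*}

/-- `f` is constant along the edges in `t`. -/
def Cut (t : Finset (Sym2 α)) (f : α → Bool) : Prop := ∀ u v, s(u, v) ∈ t → f u = f v

/-- All endpoints of the edges in `t` lie in `V`. -/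
def Within (V : Finset α) (t : Finset (Sym2 α)) : Prop := ∀ u v, s(u, v) ∈ t → u ∈ V ∧ v ∈ V

/-- The partitions of three terminals: one block, one isolated terminal, three blocks. -/
inductive BType
  | conn
  | iso (i : Fin 3)
  | sep
  deriving DecidableEq, Fintype

/-- The colourings of the terminals which are constant on the blocks. -/
def BType.resp : BType → Bool → Bool → Bool → Bool
  | .conn, x, y, z => x == y && y == z
  | .iso i, x, y, z => if i = 0 then y == z else if i = 1 then z == x else x == y
  | .sep, _, _, _ => true

/-- The number of blocks. -/
def BType.rank : BType → ℕ
  | .conn => 1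
  | .iso _ => 2
  | .sep => 3

/-- Every component of the graph `t` on `V` contains a terminal. -/
def Good (V : Finset α) (t : Finset (Sym2 α)) (τ : Fin 3 → α) : Prop :=
  ∀ f, Cut t f → (∀ i, f (τ i) = false) → ∀ v ∈ V, f v = false

/-- `π` is the partition of the terminals into the components of the graph `t`. -/
def HasBoundary (t : Finset (Sym2 α)) (τ : Fin 3 → α) (π : BType) : Prop :=
  ∀ x y z, π.resp x y z = true ↔ ∃ f, Cut t f ∧ f (τ 0) = x ∧ f (τ 1) = y ∧ f (τ 2) = z

/-- `t` is a spanning forest of `V`, each component of which contains a terminal, and it induces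
the partition `π` of the terminals. -/
structure HasType (V : Finset α) (t : Finset (Sym2 α)) (τ : Fin 3 → α) (π : BType) : Prop where
  good : Good V t τ
  boundary : HasBoundary t τ π
  card : t.card + π.rank = V.card

theorem Cut.xor {t : Finset (Sym2 α)} {f g : α → Bool} (hf : Cut t f) (hg : Cut t g) :
    Cut t (fun v => f v ^^ g v) := fun u v h => by simp only [hf u v h, hg u v h]

theorem Cut.const (t : Finset (Sym2 α)) (b : Bool) : Cut t (fun _ => b) := fun _ _ _ => rfl

/-- The realizable colourings of the terminals form a subspace of `𝔽₂³` containing the constants.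
There are exactly five such subspaces, one for each partition of the three terminals. -/
theorem exists_hasBoundary (t : Finset (Sym2 α)) (τ : Fin 3 → α) : ∃ π, HasBoundary t τ π := by
  classical
  let P : Bool → Bool → Bool → Prop :=
    fun x y z => ∃ f, Cut t f ∧ f (τ 0) = x ∧ f (τ 1) = y ∧ f (τ 2) = z
  have hx : ∀ x y z x' y' z', P x y z → P x' y' z' → P (x ^^ x') (y ^^ y') (z ^^ z') := by
    rintro _ _ _ _ _ _ ⟨f, hf, rfl, rfl, rfl⟩ ⟨g, hg, rfl, rfl, rfl⟩
    exact ⟨_, hf.xor hg, rfl, rfl, rfl⟩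
  have hc : ∀ b, P b b b := fun b => ⟨_, Cut.const t b, rfl, rfl, rfl⟩
  have hn : ∀ x y z, P x y z ↔ P (!x) (!y) (!z) := by
    intro x y z
    constructor
    · intro h; simpa using hx _ _ _ _ _ _ h (hc true)
    · intro h; simpa using hx _ _ _ _ _ _ h (hc true)
  suffices ∃ π : BType, ∀ x y z, π.resp x y z = true ↔ P x y z from this
  have hf := hc false
  have h1 := hx true false false false true false
  have h2 := hx true false false false false true
  have h3 := hx false true false false false true
  have h4 := hx true true false true false false
  have h5 := hx true true false false true false
  have h6 := hx true false true true false false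
  have h7 := hx true false true false false true
  have h8 := hx false true true false true false
  have h9 := hx false true true false false true
  have n1 := hn true false false
  have n2 := hn false true false
  have n3 := hn false false true
  have n4 := hn true true true
  simp only [Bool.xor_false, Bool.xor_true, Bool.not_true, Bool.not_false] at *
  clear hx hn hc
  clear_value P
  -- The subspace is determined by which indicators of single terminals it contains. Two of them,
  -- together with the constant, yield the third, so four of the eight cases are `sep`.
  by_cases e0 : P true false false <;> by_cases e1 : P false true false <;>
    by_cases e2 : P false false true
  on_goal 4 => refine ⟨.iso 0, ?_⟩
  on_goal 6 => refine ⟨.iso 1, ?_⟩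
  on_goal 7 => refine ⟨.iso 2, ?_⟩
  on_goal 8 => refine ⟨.conn, ?_⟩
  on_goal 1 => refine ⟨.sep, ?_⟩
  on_goal 2 => refine ⟨.sep, ?_⟩
  on_goal 3 => refine ⟨.sep, ?_⟩
  on_goal 5 => refine ⟨.sep, ?_⟩
  all_goals
    simp only [Bool.forall_bool, BType.resp]
    simp_all

theorem HasBoundary.resp_self {t : Finset (Sym2 α)} {τ : Fin 3 → α} {π : BType}
    (h : HasBoundary t τ π) {f : α → Bool} (hf : Cut t f) :
    π.resp (f (τ 0)) (f (τ 1)) (f (τ 2)) = true := (h _ _ _).2 ⟨f, hf, rfl, rfl, rfl⟩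

theorem HasBoundary.unique {t : Finset (Sym2 α)} {τ : Fin 3 → α} {π π' : BType}
    (h : HasBoundary t τ π) (h' : HasBoundary t τ π') : π = π' := by
  have : ∀ π π' : BType, (∀ x y z, π.resp x y z = true ↔ π'.resp x y z = true) → π = π' := by
    decide +kernel
  exact this _ _ fun x y z => (h x y z).trans (h' x y z).symm

variable [DecidableEq α]

/-- A graph on `V`, each component of which meets `S`, has at least `|V| - |S|` edges. -/
theorem card_le_of_cut {V : Finset α} (t : Finset (Sym2 α)) : ∀ (S : Finset α), Within V t →
    (∀ f, Cut t f → (∀ v ∈ S, f v = false) → ∀ v ∈ V, f v = false) →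
    V.card ≤ t.card + S.card := by
  induction t using Finset.induction_on with
  | empty =>
    intro S _ h
    have : V ⊆ S := by
      intro v hv
      by_contra hvS
      have := h (fun u => decide (u = v)) (fun _ _ h => by simp at h)
        (fun u hu => by simpa using fun huv : u = v => hvS (huv ▸ hu)) v hv
      simp at this
    simpa using Finset.card_le_card this
  | insert e t he ih =>
    intro S hw h
    induction e using Sym2.ind with | _ u v
    have hw' : Within V t := fun a b hab => hw a b (Finset.mem_insert_of_mem hab)
    have hcut : ∀ f, Cut t f → f u = f v → Cut (insert s(u, v) t) f := by
      intro f hf huv a b hab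
      rcases Finset.mem_insert.1 hab with hab | hab
      · rcases Sym2.eq_iff.1 hab with ⟨rfl, rfl⟩ | ⟨rfl, rfl⟩
        · exact huv
        · exact huv.symm
      · exact hf a b hab
    -- Deleting an edge `uv` costs at most one new point of `S`, either `u` or `v`. If neither
    -- sufficed, there would be bad colourings `f` with values `0, 1` and `g` with values `1, 0` at
    -- `u, v`; then `f ^^ g` is `1` at both ends, respects the edge and vanishes on `S`, a
    -- contradiction.
    have key : ∃ w, ∀ f, Cut t f → (∀ v ∈ insert w S, f v = false) → ∀ v ∈ V, f v = false := by
      by_contra hno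
      push Not at hno
      obtain ⟨f, hf, hfS, a, ha, hfa⟩ := hno u
      obtain ⟨g, hg, hgS, b, hb, hgb⟩ := hno v
      have hfu := hfS u (by simp)
      have hgv := hgS v (by simp)
      have hfv : f v = true := by
        by_contra hfv
        exact hfa (h f (hcut f hf (by simp_all)) (fun x hx => hfS x (by simp [hx])) a ha)
      have hgu : g u = true := by
        by_contra hgu
        exact hgb (h g (hcut g hg (by simp_all)) (fun x hx => hgS x (by simp [hx])) b hb)
      have := h _ (hcut _ (hf.xor hg) (by simp [hfu, hfv, hgu, hgv]))
        (fun x hx => by simp [hfS x (by simp [hx]), hgS x (by simp [hx])]) u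
        (hw u v (by simp)).1
      simp [hfu, hgu] at this
    obtain ⟨w, hwS⟩ := key
    have := ih (insert w S) hw' hwS
    have := Finset.card_insert_le w S
    rw [Finset.card_insert_of_notMem he]
    omega

/-- One terminal chosen from each block meets every component, so `card_le_of_cut` applies with
`π.rank` points. -/
theorem HasBoundary.card_le {V : Finset α} {t : Finset (Sym2 α)} {τ : Fin 3 → α} {π : BType}
    (h : HasBoundary t τ π) (hg : Good V t τ) (hw : Within V t) :
    V.card ≤ t.card + π.rank := by
  have key : ∀ S : Finset α, S.card ≤ π.rank →
      (∀ f : α → Bool, π.resp (f (τ 0)) (f (τ 1)) (f (τ 2)) = true → (∀ v ∈ S, f v = false) →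
        f (τ 0) = false ∧ f (τ 1) = false ∧ f (τ 2) = false) →
      V.card ≤ t.card + π.rank := by
    intro S hS hf
    refine (card_le_of_cut t S hw fun f hcut hfS => hg f hcut ?_).trans (by omega)
    have := hf f ((h _ _ _).2 ⟨f, hcut, rfl, rfl, rfl⟩) hfS
    intro i
    fin_cases i
    exacts [this.1, this.2.1, this.2.2]
  cases π with
  | conn =>
    exact key {τ 0} (by simp [BType.rank]) (by simp +contextual [BType.resp])
  | iso i =>
    refine key {τ i, τ (i + 1)} Finset.card_le_two ?_
    intro f hr hf
    have h1 := hf (τ i) (by simp)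
    have h2 := hf (τ (i + 1)) (by simp)
    fin_cases i <;> simp_all [BType.resp]
  | sep =>
    exact key {τ 0, τ 1, τ 2} Finset.card_le_three (by simp +contextual)

end Boundary

/-! ### Gluing three pieces along pairwise common terminals. -/

section Glue

variable {α : Type*}

/-- `V` consists of three pieces `W 0, W 1, W 2`; the terminals `τ i j = τ j i` with `i ≠ j` are
common to `W i` and `W j`, and the terminals `τ i i` are those of `V`. -/
structure IsGlue (V : Finset α) (W : Fin 3 → Finset α) (τ : Fin 3 → Fin 3 → α) : Prop where
  symm : ∀ i j, τ i j = τ j i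
  mem : ∀ i j, τ i j ∈ W i
  inter : ∀ i j, i ≠ j → ∀ v ∈ W i, v ∈ W j → v = τ i j
  union : ∀ v, v ∈ V ↔ ∃ i, v ∈ W i
  card : V.card + 3 = ∑ i, (W i).card

/-- After gluing pieces with boundary partitions `p, q, r`, every junction is connected to an
outer terminal. -/
def GlueGood (p q r : BType) : Prop :=
  ∀ a b c, p.resp false a b = true → q.resp a false c = true → r.resp b c false = true →
    a = false ∧ b = false ∧ c = false

/-- After gluing pieces with boundary partitions `p, q, r`, the outer terminals are connected
according to `π`. -/
def GlueBoundary (p q r π : BType) : Prop :=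
  ∀ x y z, π.resp x y z = true ↔
    ∃ a b c, p.resp x a b = true ∧ q.resp a y c = true ∧ r.resp b c z = true

/-- The result of gluing forests with boundary partitions `p, q, r` is a forest with boundary
partition `π`. -/
def GlueRel (p q r π : BType) : Prop :=
  GlueGood p q r ∧ GlueBoundary p q r π ∧ p.rank + q.rank + r.rank = π.rank + 3

instance (p q r : BType) : Decidable (GlueGood p q r) := by unfold GlueGood; infer_instance

instance (p q r π : BType) : Decidable (GlueBoundary p q r π) := by
  unfold GlueBoundary; infer_instance

instance (p q r π : BType) : Decidable (GlueRel p q r π) := by unfold GlueRel; infer_instance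

/-- This finite check is what turns the edge count of the glued forest into tight edge counts on the
pieces. -/
theorem rank_le_of_glue : ∀ p q r π : BType, GlueGood p q r → GlueBoundary p q r π →
    p.rank + q.rank + r.rank ≤ π.rank + 3 := by
  decide +kernel

theorem Cut.congr {V : Finset α} {t : Finset (Sym2 α)} {f g : α → Bool} (hf : Cut t f)
    (hw : Within V t) (h : ∀ v ∈ V, g v = f v) : Cut t g := fun u v huv => by
  rw [h u (hw u v huv).1, h v (hw u v huv).2, hf u v huv]

variable {V : Finset α} {W : Fin 3 → Finset α} {τ : Fin 3 → Fin 3 → α}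

theorem IsGlue.exists_paste (hG : IsGlue V W τ) (f : Fin 3 → α → Bool)
    (h : ∀ i j, f i (τ i j) = f j (τ i j)) : ∃ F : α → Bool, ∀ i, ∀ v ∈ W i, F v = f i v := by
  classical
  refine ⟨fun v => if hv : ∃ i, v ∈ W i then f hv.choose v else false, fun i v hv => ?_⟩
  have hex : ∃ i, v ∈ W i := ⟨i, hv⟩
  simp only [hex, dif_pos]
  by_cases hi : hex.choose = i
  · rw [hi]
  · have := hG.inter _ _ hi v hex.choose_spec hv
    have h2 := h hex.choose i
    rwa [← this] at h2

variable [DecidableEq α]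

theorem cut_biUnion {t : Fin 3 → Finset (Sym2 α)} {f : α → Bool} :
    Cut (Finset.univ.biUnion t) f ↔ ∀ i, Cut (t i) f := by
  simp only [Cut, Finset.mem_biUnion, Finset.mem_univ, true_and]
  exact ⟨fun h i u v hi => h u v ⟨i, hi⟩, fun h u v ⟨i, hi⟩ => h i u v hi⟩

/-- A colouring of one piece that vanishes at its terminals extends by `false` to the other pieces,
so a component missing the terminals of the piece would miss all outer terminals as well. -/
theorem IsGlue.good_piece (hG : IsGlue V W τ) {t : Fin 3 → Finset (Sym2 α)}
    (hw : ∀ i, Within (W i) (t i)) (hg : Good V (Finset.univ.biUnion t) (fun i => τ i i))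
    (i : Fin 3) : Good (W i) (t i) (τ i) := by
  intro f hf h0 v hv
  obtain ⟨F, hF⟩ := hG.exists_paste (fun j => if j = i then f else fun _ => false) (by
    intro j k
    by_cases hj : j = i <;> by_cases hk : k = i
    · simp [hj, hk]
    · simp [hj, hk, h0]
    · simp [hj, hk, h0, hG.symm j i]
    · simp [hj, hk])
  have hcut : Cut (Finset.univ.biUnion t) F := cut_biUnion.2 fun j => by
    refine Cut.congr ?_ (hw j) (hF j)
    by_cases hj : j = i
    · subst hj; simpa using hf
    · simpa [hj] using Cut.const (t j) false
  have := hg F hcut (fun j => by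
    rw [hF j _ (hG.mem j j)]
    by_cases hj : j = i
    · subst hj; simpa using h0 j
    · simp [hj]) v ((hG.union v).2 ⟨i, hv⟩)
  rw [hF i v hv] at this
  simpa using this

theorem IsGlue.exists_cut (hG : IsGlue V W τ) {t : Fin 3 → Finset (Sym2 α)}
    (hw : ∀ i, Within (W i) (t i)) {p : Fin 3 → BType} (hp : ∀ i, HasBoundary (t i) (τ i) (p i))
    {x y z a b c : Bool} (h0 : (p 0).resp x a b = true) (h1 : (p 1).resp a y c = true)
    (h2 : (p 2).resp b c z = true) :
    ∃ f, Cut (Finset.univ.biUnion t) f ∧ f (τ 0 0) = x ∧ f (τ 1 1) = y ∧ f (τ 2 2) = z ∧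
      f (τ 0 1) = a ∧ f (τ 0 2) = b ∧ f (τ 1 2) = c := by
  obtain ⟨f0, hf0, h00, h01, h02⟩ := (hp 0 _ _ _).1 h0
  obtain ⟨f1, hf1, h10, h11, h12⟩ := (hp 1 _ _ _).1 h1
  obtain ⟨f2, hf2, h20, h21, h22⟩ := (hp 2 _ _ _).1 h2
  rw [hG.symm 1 0] at h10
  rw [hG.symm 2 0] at h20
  rw [hG.symm 2 1] at h21
  have s10 := hG.symm 1 0
  have s20 := hG.symm 2 0
  have s21 := hG.symm 2 1
  obtain ⟨F, hF⟩ := hG.exists_paste ![f0, f1, f2] (by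
    intro i j
    fin_cases i <;> fin_cases j <;> simp [*])
  have hcut : Cut (Finset.univ.biUnion t) F := cut_biUnion.2 fun j => by
    refine Cut.congr ?_ (hw j) (hF j)
    fin_cases j
    exacts [hf0, hf1, hf2]
  refine ⟨F, hcut, ?_, ?_, ?_, ?_, ?_, ?_⟩
  · rw [hF 0 _ (hG.mem 0 0)]; exact h00
  · rw [hF 1 _ (hG.mem 1 1)]; exact h11
  · rw [hF 2 _ (hG.mem 2 2)]; exact h22
  · rw [hF 0 _ (hG.mem 0 1)]; exact h01
  · rw [hF 0 _ (hG.mem 0 2)]; exact h02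
  · rw [hF 1 _ (hG.mem 1 2)]; exact h12

theorem IsGlue.hasType_iff (hG : IsGlue V W τ) {t : Fin 3 → Finset (Sym2 α)}
    (hw : ∀ i, Within (W i) (t i)) (hd : ∀ i j, i ≠ j → Disjoint (t i) (t j)) (π : BType) :
    HasType V (Finset.univ.biUnion t) (fun i => τ i i) π ↔
      ∃ p : Fin 3 → BType, GlueRel (p 0) (p 1) (p 2) π ∧
        ∀ i, HasType (W i) (t i) (τ i) (p i) := by
  have hcard : (Finset.univ.biUnion t).card = ∑ i, (t i).card :=
    Finset.card_biUnion fun i _ j _ hij => hd i j hij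
  have hV := hG.card
  have s10 := hG.symm 1 0
  have s20 := hG.symm 2 0
  have s21 := hG.symm 2 1
  have hresp : ∀ {p : Fin 3 → BType}, (∀ i, HasBoundary (t i) (τ i) (p i)) →
      ∀ {f}, Cut (Finset.univ.biUnion t) f →
      (p 0).resp (f (τ 0 0)) (f (τ 0 1)) (f (τ 0 2)) = true ∧
      (p 1).resp (f (τ 0 1)) (f (τ 1 1)) (f (τ 1 2)) = true ∧
      (p 2).resp (f (τ 0 2)) (f (τ 1 2)) (f (τ 2 2)) = true := by
    intro p hp f hf
    have hf' := cut_biUnion.1 hf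
    have h0 := (hp 0).resp_self (hf' 0)
    have h1 := (hp 1).resp_self (hf' 1)
    have h2 := (hp 2).resp_self (hf' 2)
    rw [s10] at h1
    rw [s20, s21] at h2
    exact ⟨h0, h1, h2⟩
  rw [Fin.sum_univ_three] at hcard hV
  constructor
  · intro h
    choose p hp using fun i => exists_hasBoundary (t i) (τ i)
    have hg := hG.good_piece hw h.good
    have hle := fun i => (hp i).card_le (hg i) (hw i)
    have h1 : GlueGood (p 0) (p 1) (p 2) := by
      intro a b c h0 h1 h2
      obtain ⟨f, hf, hx, hy, hz, rfl, rfl, rfl⟩ := hG.exists_cut hw hp h0 h1 h2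
      have := h.good f hf (fun i => by fin_cases i <;> assumption)
      exact ⟨this _ ((hG.union _).2 ⟨0, hG.mem 0 1⟩), this _ ((hG.union _).2 ⟨0, hG.mem 0 2⟩),
        this _ ((hG.union _).2 ⟨1, hG.mem 1 2⟩)⟩
    have h2 : GlueBoundary (p 0) (p 1) (p 2) π := by
      intro x y z
      rw [h.boundary x y z]
      constructor
      · rintro ⟨f, hf, rfl, rfl, rfl⟩
        exact ⟨_, _, _, hresp hp hf⟩
      · rintro ⟨a, b, c, h0, h1, h2⟩
        obtain ⟨f, hf, hx, hy, hz, -⟩ := hG.exists_cut hw hp h0 h1 h2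
        exact ⟨f, hf, hx, hy, hz⟩
    -- The inequalities `|W i| ≤ |t i| + rank` sum to at most `|t| + rank π + 3 = |V| + 3 = ∑ |W
    -- i|`, so each of them is an equality and every piece is a forest.
    have h3 := rank_le_of_glue _ _ _ _ h1 h2
    have h4 := h.card
    have l0 := hle 0
    have l1 := hle 1
    have l2 := hle 2
    refine ⟨p, ⟨h1, h2, by omega⟩, fun i => ⟨hg i, hp i, ?_⟩⟩
    fin_cases i <;> simp only [Fin.zero_eta, Fin.mk_one, Fin.reduceFinMk] <;> omega
  · rintro ⟨p, ⟨h1, h2, h3⟩, hp⟩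
    have hp' := fun i => (hp i).boundary
    refine ⟨?_, ?_, ?_⟩
    · intro f hf h0 v hv
      have e0 : f (τ 0 0) = false := h0 0
      have e1 : f (τ 1 1) = false := h0 1
      have e2 : f (τ 2 2) = false := h0 2
      obtain ⟨r0, r1, r2⟩ := hresp hp' hf
      rw [e0] at r0
      rw [e1] at r1
      rw [e2] at r2
      obtain ⟨f01, f02, f12⟩ := h1 _ _ _ r0 r1 r2
      obtain ⟨i, hi⟩ := (hG.union v).1 hv
      refine (hp i).good f (cut_biUnion.1 hf i) (fun j => ?_) v hi
      fin_cases i <;> fin_cases j <;> simp_all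
    · intro x y z
      rw [h2 x y z]
      constructor
      · rintro ⟨a, b, c, h0, h1, h2⟩
        obtain ⟨f, hf, hx, hy, hz, -⟩ := hG.exists_cut hw hp' h0 h1 h2
        exact ⟨f, hf, hx, hy, hz⟩
      · rintro ⟨f, hf, rfl, rfl, rfl⟩
        exact ⟨_, _, _, hresp hp' hf⟩
    · have c0 := (hp 0).card
      have c1 := (hp 1).card
      have c2 := (hp 2).card
      omega

end Glue

end Sierpinski

namespace Sierpinski

/-! ### Generating functions of forests and their gluing rule. -/

section ForestSum

variable {α : Type*} {R : Type*} [CommSemiring R]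

open Classical in
/-- The generating function of the spanning forests of boundary type `π` in the graph `(V, E)`
with terminals `τ` and edge weights `ω`. -/
noncomputable def forestSum (V : Finset α) (E : Finset (Sym2 α)) (τ : Fin 3 → α)
    (ω : Sym2 α → R) (π : BType) : R :=
  ∑ t ∈ E.powerset with HasType V t τ π, ∏ e ∈ t, ω e

theorem forestSum_congr {V : Finset α} {E : Finset (Sym2 α)} {τ : Fin 3 → α}
    {ω ω' : Sym2 α → R} (h : ∀ e ∈ E, ω e = ω' e) (π : BType) :
    forestSum V E τ ω π = forestSum V E τ ω' π := by
  classical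
  refine Finset.sum_congr rfl fun t ht => Finset.prod_congr rfl fun e he => h e ?_
  exact Finset.mem_powerset.1 (Finset.mem_filter.1 ht).1 he

theorem Within.mono {V : Finset α} {E t : Finset (Sym2 α)} (h : Within V E) (ht : t ⊆ E) :
    Within V t := fun u v huv => h u v (ht huv)

theorem HasType.unique {V : Finset α} {t : Finset (Sym2 α)} {τ : Fin 3 → α} {π π' : BType}
    (h : HasType V t τ π) (h' : HasType V t τ π') : π = π' := h.boundary.unique h'.boundary

variable [DecidableEq α] {V : Finset α} {W : Fin 3 → Finset α} {τ : Fin 3 → Fin 3 → α}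

/-- A subset of the glued edge set is the same as a triple of subsets `t ∩ E i`; the types of these
pieces are unique, so the weighted sum factors type by type. -/
theorem IsGlue.forestSum_eq (hG : IsGlue V W τ) {E : Fin 3 → Finset (Sym2 α)}
    (hw : ∀ i, Within (W i) (E i)) (hd : ∀ i j, i ≠ j → Disjoint (E i) (E j))
    (ω : Sym2 α → R) (π : BType) :
    forestSum V (Finset.univ.biUnion E) (fun i => τ i i) ω π =
      ∑ p : Fin 3 → BType with GlueRel (p 0) (p 1) (p 2) π,
        ∏ i, forestSum (W i) (E i) (τ i) ω (p i) := by
  classical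
  simp only [forestSum, Finset.prod_univ_sum]
  rw [Finset.sum_sigma']
  have hinter : ∀ t : Fin 3 → Finset (Sym2 α), (∀ i, t i ⊆ E i) → ∀ i,
      (Finset.univ.biUnion t) ∩ E i = t i := by
    intro t ht i
    ext e
    simp only [Finset.mem_inter, Finset.mem_biUnion, Finset.mem_univ, true_and]
    constructor
    · rintro ⟨⟨j, hj⟩, hi⟩
      by_cases hij : i = j
      · exact hij ▸ hj
      · exact absurd (ht j hj) (Finset.disjoint_left.1 (hd i j hij) hi)
    · exact fun h => ⟨⟨i, h⟩, ht i h⟩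
  symm
  refine Finset.sum_bij (fun x _ => Finset.univ.biUnion x.2) ?_ ?_ ?_ ?_
  · rintro ⟨p, t⟩ hx
    simp only [Finset.mem_sigma, Finset.mem_filter, Finset.mem_univ, true_and,
      Fintype.mem_piFinset, Finset.mem_powerset] at hx ⊢
    exact ⟨Finset.biUnion_subset.2 fun i _ => (hx.2 i).1.trans
      (Finset.subset_biUnion_of_mem E (Finset.mem_univ i)),
      (hG.hasType_iff (fun i => (hw i).mono (hx.2 i).1)
        (fun i j hij => (hd i j hij).mono (hx.2 i).1 (hx.2 j).1) π).2
        ⟨p, hx.1, fun i => (hx.2 i).2⟩⟩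
  · rintro ⟨p, t⟩ hx ⟨p', t'⟩ hx' heq
    simp only [Finset.mem_sigma, Finset.mem_filter, Finset.mem_univ, true_and,
      Fintype.mem_piFinset, Finset.mem_powerset] at hx hx' heq
    have ht : t = t' := funext fun i => by
      rw [← hinter t (fun i => (hx.2 i).1), ← hinter t' (fun i => (hx'.2 i).1), heq]
    subst ht
    have hp : p = p' := funext fun i => (hx.2 i).2.unique (hx'.2 i).2
    rw [hp]
  · intro t ht
    simp only [Finset.mem_filter, Finset.mem_powerset] at ht
    have hu : Finset.univ.biUnion (fun i => t ∩ E i) = t := by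
      rw [← Finset.inter_biUnion, Finset.inter_eq_left.2 ht.1]
    have h2 := ht.2
    rw [← hu] at h2
    obtain ⟨p, hp, hpt⟩ := (hG.hasType_iff (fun i => (hw i).mono Finset.inter_subset_right)
        (fun i j hij => (hd i j hij).mono Finset.inter_subset_right Finset.inter_subset_right)
        π).1 h2
    refine ⟨⟨p, fun i => t ∩ E i⟩, ?_, hu⟩
    simp only [Finset.mem_sigma, Finset.mem_filter, Finset.mem_univ, true_and,
      Fintype.mem_piFinset, Finset.mem_powerset]
    exact ⟨hp, fun i => ⟨Finset.inter_subset_right, hpt i⟩⟩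
  · rintro ⟨p, t⟩ hx
    simp only [Finset.mem_sigma, Finset.mem_filter, Finset.mem_univ, true_and,
      Fintype.mem_piFinset, Finset.mem_powerset] at hx
    exact (Finset.prod_biUnion fun i _ j _ hij =>
      (hd i j hij).mono (hx.2 i).1 (hx.2 j).1).symm

/-- The triples of boundary types which glue to a given boundary type. -/
def glueList : BType → List (BType × BType × BType)
  | .conn => [(.conn, .conn, .iso 0), (.conn, .conn, .iso 1), (.conn, .iso 0, .conn),
      (.conn, .iso 2, .conn), (.iso 1, .conn, .conn), (.iso 2, .conn, .conn)]
  | .iso i =>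
    if i = 0 then
      [(.conn, .iso 0, .iso 0), (.iso 0, .conn, .iso 0), (.iso 0, .conn, .iso 1),
        (.iso 0, .iso 0, .conn), (.iso 0, .iso 2, .conn), (.iso 1, .conn, .iso 0),
        (.iso 2, .iso 0, .conn), (.sep, .conn, .conn)]
    else if i = 1 then
      [(.conn, .iso 0, .iso 1), (.conn, .iso 1, .iso 0), (.conn, .iso 1, .iso 1),
        (.conn, .sep, .conn), (.iso 1, .conn, .iso 1), (.iso 1, .iso 1, .conn),
        (.iso 1, .iso 2, .conn), (.iso 2, .iso 1, .conn)]
    else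
      [(.conn, .conn, .sep), (.conn, .iso 0, .iso 2), (.conn, .iso 2, .iso 0),
        (.conn, .iso 2, .iso 2), (.iso 1, .conn, .iso 2), (.iso 2, .conn, .iso 1),
        (.iso 2, .conn, .iso 2), (.iso 2, .iso 2, .conn)]
  | .sep => [(.conn, .iso 0, .sep), (.conn, .iso 1, .sep), (.conn, .sep, .iso 0),
      (.conn, .sep, .iso 2), (.iso 0, .conn, .sep), (.iso 0, .iso 0, .iso 1),
      (.iso 0, .iso 0, .iso 2), (.iso 0, .iso 1, .iso 0), (.iso 0, .iso 1, .iso 1),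
      (.iso 0, .iso 2, .iso 0), (.iso 0, .iso 2, .iso 2), (.iso 0, .sep, .conn),
      (.iso 1, .conn, .sep), (.iso 1, .iso 1, .iso 0), (.iso 1, .iso 1, .iso 2),
      (.iso 1, .iso 2, .iso 0), (.iso 1, .iso 2, .iso 2), (.iso 2, .iso 0, .iso 1),
      (.iso 2, .iso 0, .iso 2), (.iso 2, .iso 1, .iso 1), (.iso 2, .iso 1, .iso 2),
      (.iso 2, .sep, .conn), (.sep, .conn, .iso 1), (.sep, .conn, .iso 2),
      (.sep, .iso 1, .conn), (.sep, .iso 2, .conn)]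

theorem mem_glueList : ∀ p q r π : BType, (p, q, r) ∈ glueList π ↔ GlueRel p q r π := by
  decide +kernel

theorem nodup_glueList : ∀ π : BType, (glueList π).Nodup := by
  decide +kernel

/-- The generating functions of a graph glued from three pieces, in terms of those of the
pieces. -/
def glueSum (F G H : BType → R) (π : BType) : R :=
  ((glueList π).map fun x => F x.1 * G x.2.1 * H x.2.2).sum

theorem IsGlue.forestSum_eq_glueSum (hG : IsGlue V W τ) {E : Fin 3 → Finset (Sym2 α)}
    (hw : ∀ i, Within (W i) (E i)) (hd : ∀ i j, i ≠ j → Disjoint (E i) (E j))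
    (ω : Sym2 α → R) :
    forestSum V (Finset.univ.biUnion E) (fun i => τ i i) ω =
      glueSum (forestSum (W 0) (E 0) (τ 0) ω) (forestSum (W 1) (E 1) (τ 1) ω)
        (forestSum (W 2) (E 2) (τ 2) ω) := by
  funext π
  rw [hG.forestSum_eq hw hd, glueSum, ← List.sum_toFinset _ (nodup_glueList π)]
  refine Finset.sum_nbij' (fun p => (p 0, p 1, p 2)) (fun x => ![x.1, x.2.1, x.2.2]) ?_ ?_ ?_ ?_ ?_
  · intro p hp
    simpa [mem_glueList] using hp
  · rintro ⟨p, q, r⟩ hp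
    simpa [mem_glueList] using hp
  · intro p _
    ext i
    fin_cases i <;> rfl
  · intro x _
    rfl
  · intro p _
    rw [Fin.prod_univ_three]

end ForestSum

/-! ### Invariance under injective relabelling of the vertices. -/

section Map

variable {α β : Type*} [DecidableEq β]

theorem cut_image {φ : α → β} {t : Finset (Sym2 α)} {f : β → Bool} :
    Cut (t.image (Sym2.map φ)) f ↔ Cut t (f ∘ φ) := by
  constructor
  · exact fun h u v huv => h _ _ (Finset.mem_image.2 ⟨_, huv, rfl⟩)
  · intro h u v huv
    obtain ⟨e, he, heq⟩ := Finset.mem_image.1 huv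
    induction e using Sym2.ind with | _ a b
    have := h a b he
    rcases Sym2.eq_iff.1 heq with ⟨rfl, rfl⟩ | ⟨rfl, rfl⟩
    · exact this
    · exact this.symm

theorem hasType_image {φ : α → β} (hφ : Function.Injective φ) {V : Finset α}
    {t : Finset (Sym2 α)} {τ : Fin 3 → α} {π : BType} :
    HasType (V.image φ) (t.image (Sym2.map φ)) (φ ∘ τ) π ↔ HasType V t τ π := by
  have hc : ((t.image (Sym2.map φ)).card + π.rank = (V.image φ).card) ↔
      (t.card + π.rank = V.card) := by
    rw [Finset.card_image_of_injective _ hφ,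
      Finset.card_image_of_injective _ (Sym2.map.injective hφ)]
  have hext : ∀ f : α → Bool, ∃ g : β → Bool, g ∘ φ = f := fun f =>
    ⟨Function.extend φ f fun _ => false, funext fun a => hφ.extend_apply f _ a⟩
  have hg : Good (V.image φ) (t.image (Sym2.map φ)) (φ ∘ τ) ↔ Good V t τ := by
    simp only [Good, cut_image, Finset.forall_mem_image]
    constructor
    · intro h f
      obtain ⟨g, rfl⟩ := hext f
      exact h g
    · exact fun h f => h (f ∘ φ)
  have hb : HasBoundary (t.image (Sym2.map φ)) (φ ∘ τ) π ↔ HasBoundary t τ π := by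
    refine forall_congr' fun x => forall_congr' fun y => forall_congr' fun z =>
      iff_congr Iff.rfl ?_
    simp only [cut_image]
    constructor
    · rintro ⟨f, hf⟩
      exact ⟨f ∘ φ, hf⟩
    · rintro ⟨f, hf⟩
      obtain ⟨g, rfl⟩ := hext f
      exact ⟨g, hf⟩
  exact ⟨fun h => ⟨hg.1 h.good, hb.1 h.boundary, hc.1 h.card⟩,
    fun h => ⟨hg.2 h.good, hb.2 h.boundary, hc.2 h.card⟩⟩

theorem forestSum_image {R : Type*} [CommSemiring R] {φ : α → β} (hφ : Function.Injective φ)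
    (V : Finset α) (E : Finset (Sym2 α)) (τ : Fin 3 → α) (ω : Sym2 β → R) :
    forestSum (V.image φ) (E.image (Sym2.map φ)) (φ ∘ τ) ω =
      forestSum V E τ (ω ∘ Sym2.map φ) := by
  classical
  funext π
  have hinj := Sym2.map.injective hφ
  rw [forestSum, Finset.powerset_image, Finset.filter_image, Finset.sum_image, forestSum]
  · simp only [hasType_image hφ]
    refine Finset.sum_congr rfl fun t _ => ?_
    rw [Finset.prod_image hinj.injOn]
    rfl
  · exact (Finset.image_injective hinj).injOn

end Map

/-! ### The single triangle, the initial piece of the recursion. -/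

section Triangle

variable {α : Type*}

/-- The edge of the triangle `σ` opposite to `σ i`. -/
def oppEdge (σ : Fin 3 → α) (i : Fin 3) : Sym2 α := s(σ (i + 1), σ (i + 2))

theorem oppEdge_injective {σ : Fin 3 → α} (hσ : Function.Injective σ) :
    Function.Injective (oppEdge σ) := by
  intro i j h
  have : ∀ i j : Fin 3, (i + 1 = j + 1 ∧ i + 2 = j + 2 ∨ i + 1 = j + 2 ∧ i + 2 = j + 1) →
    i = j := by decide
  apply this
  simpa only [oppEdge, Sym2.eq_iff, hσ.eq_iff] using h

/-- The sets of edges of a triangle which are forests of the given boundary type. -/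
def triangleForests : BType → Finset (Finset (Fin 3))
  | .conn => {{0, 1}, {1, 2}, {2, 0}}
  | .iso i => {{i}}
  | .sep => {∅}

theorem mem_triangleForests : ∀ (s : Finset (Fin 3)) (π : BType), s ∈ triangleForests π ↔
    (∀ x y z, π.resp x y z = true ↔ (0 ∈ s → y = z) ∧ (1 ∈ s → z = x) ∧ (2 ∈ s → x = y)) ∧
      s.card + π.rank = 3 := by
  decide +kernel

theorem hasType_triangle [DecidableEq α] {σ : Fin 3 → α} (hσ : Function.Injective σ) (s : Finset (Fin 3))
    (π : BType) : HasType (Finset.univ.image σ) (s.image (oppEdge σ)) σ π ↔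
      s ∈ triangleForests π := by
  have hcut : ∀ f : α → Bool, Cut (s.image (oppEdge σ)) f ↔
      (0 ∈ s → f (σ 1) = f (σ 2)) ∧ (1 ∈ s → f (σ 2) = f (σ 0)) ∧
        (2 ∈ s → f (σ 0) = f (σ 1)) := by
    intro f
    constructor
    · intro h
      have h' : ∀ i ∈ s, f (σ (i + 1)) = f (σ (i + 2)) := fun i hi =>
        h _ _ (Finset.mem_image_of_mem (oppEdge σ) hi)
      exact ⟨h' 0, h' 1, h' 2⟩
    · rintro ⟨h0, h1, h2⟩ u v huv
      obtain ⟨i, hi, heq⟩ := Finset.mem_image.1 huv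
      have key : f (σ (i + 1)) = f (σ (i + 2)) := by
        fin_cases i
        exacts [h0 hi, h1 hi, h2 hi]
      rcases Sym2.eq_iff.1 heq with ⟨rfl, rfl⟩ | ⟨rfl, rfl⟩
      · exact key
      · exact key.symm
  have hext : ∀ x y z : Bool, ∃ f : α → Bool, f (σ 0) = x ∧ f (σ 1) = y ∧ f (σ 2) = z :=
    fun x y z => ⟨Function.extend σ ![x, y, z] fun _ => false, by simp [hσ.extend_apply]⟩
  have hb : HasBoundary (s.image (oppEdge σ)) σ π ↔ ∀ x y z, π.resp x y z = true ↔
      (0 ∈ s → y = z) ∧ (1 ∈ s → z = x) ∧ (2 ∈ s → x = y) := by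
    refine forall_congr' fun x => forall_congr' fun y => forall_congr' fun z =>
      iff_congr Iff.rfl ?_
    simp only [hcut]
    constructor
    · rintro ⟨f, hf, rfl, rfl, rfl⟩
      exact hf
    · intro h
      obtain ⟨f, rfl, rfl, rfl⟩ := hext x y z
      exact ⟨f, h, rfl, rfl, rfl⟩
  have hc : (s.image (oppEdge σ)).card + π.rank = (Finset.univ.image σ).card ↔
      s.card + π.rank = 3 := by
    rw [Finset.card_image_of_injective _ hσ,
      Finset.card_image_of_injective _ (oppEdge_injective hσ)]
    rfl
  have hg : Good (Finset.univ.image σ) (s.image (oppEdge σ)) σ := by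
    intro f _ h v hv
    obtain ⟨i, -, rfl⟩ := Finset.mem_image.1 hv
    exact h i
  rw [mem_triangleForests, ← hb, ← hc]
  exact ⟨fun h => ⟨h.boundary, h.card⟩, fun h => ⟨hg, h.1, h.2⟩⟩

/-- The generating functions of a triangle with weight `x i` at the edge opposite to vertex `i`. -/
def triangleSum {R : Type*} [CommSemiring R] (x : Fin 3 → R) : BType → R
  | .conn => x 0 * x 1 + x 1 * x 2 + x 2 * x 0
  | .iso i => x i
  | .sep => 1

theorem forestSum_triangle [DecidableEq α] {R : Type*} [CommSemiring R] {σ : Fin 3 → α}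
    (hσ : Function.Injective σ) (ω : Sym2 α → R) :
    forestSum (Finset.univ.image σ) (Finset.univ.image (oppEdge σ)) σ ω =
      triangleSum (fun i => ω (oppEdge σ i)) := by
  classical
  funext π
  have hinj := oppEdge_injective hσ
  rw [forestSum, Finset.powerset_image, Finset.filter_image, Finset.sum_image
    (Finset.image_injective hinj).injOn]
  simp only [hasType_triangle hσ, Finset.powerset_univ, Finset.filter_univ_mem,
    Finset.prod_image hinj.injOn]
  cases π with
  | conn =>
    simp only [triangleForests, triangleSum]
    rw [Finset.sum_insert (by decide), Finset.sum_insert (by decide), Finset.sum_singleton,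
      Finset.prod_pair (by decide), Finset.prod_pair (by decide), Finset.prod_pair (by decide),
      add_assoc]
  | iso i => simp [triangleForests, triangleSum]
  | sep => simp [triangleForests, triangleSum]

end Triangle

end Sierpinski

namespace Sierpinski

/-! ### Spanning trees as forests of type `conn`. -/

section Tree

variable {α : Type*} {V : Finset α} {t : Finset (Sym2 α)}

theorem connected_induce_iff (hV : V.Nonempty) (hw : Within V t) :
    ((SimpleGraph.fromEdgeSet (t : Set (Sym2 α))).induce (V : Set α)).Connected ↔
      ∀ f, Cut t f → ∀ u ∈ V, ∀ v ∈ V, f u = f v := by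
  classical
  set G := (SimpleGraph.fromEdgeSet (t : Set (Sym2 α))).induce (V : Set α)
  constructor
  · intro h f hf u hu v hv
    obtain ⟨p⟩ := h.preconnected ⟨u, hu⟩ ⟨v, hv⟩
    have key : ∀ (a b : (V : Set α)), G.Walk a b → f a = f b := by
      intro a b p
      induction p with
      | nil => rfl
      | cons hadj _ ih =>
        rw [← ih]
        simp only [G, SimpleGraph.comap_adj, Function.Embedding.subtype_apply,
          SimpleGraph.fromEdgeSet_adj, Finset.mem_coe] at hadj
        exact hf _ _ hadj.1
    exact key _ _ p
  · intro h
    have : Nonempty (V : Set α) := ⟨⟨_, hV.choose_spec⟩⟩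
    refine ⟨fun u v => ?_⟩
    -- The indicator of the component of `u` is a cut, so by hypothesis it is constant on `V`.
    let f : α → Bool := fun w => decide (∃ hw : w ∈ V, G.Reachable u ⟨w, hw⟩)
    have hstep : ∀ a b, s(a, b) ∈ t → f a = true → f b = true := by
      intro a b hab ha
      obtain ⟨haV, hr⟩ := of_decide_eq_true ha
      have hbV := (hw a b hab).2
      refine decide_eq_true ⟨hbV, ?_⟩
      by_cases hne : a = b
      · subst hne; exact hr
      · refine hr.trans (SimpleGraph.Adj.reachable ?_)
        simp only [G, SimpleGraph.comap_adj, Function.Embedding.subtype_apply,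
          SimpleGraph.fromEdgeSet_adj, Finset.mem_coe]
        exact ⟨hab, hne⟩
    have hcut : Cut t f := fun a b hab => by
      have h1 := hstep a b hab
      have h2 := hstep b a (Sym2.eq_swap ▸ hab)
      exact Bool.eq_iff_iff.2 ⟨h1, h2⟩
    have hu : f u = true := decide_eq_true ⟨u.2, SimpleGraph.Reachable.refl _⟩
    have hv := (h f hcut u u.2 v v.2).symm.trans hu
    exact (of_decide_eq_true hv).2

theorem card_edgeSet_induce (hw : Within V t) (hl : ∀ e ∈ t, ¬ e.IsDiag) :
    Nat.card ((SimpleGraph.fromEdgeSet (t : Set (Sym2 α))).induce (V : Set α)).edgeSet =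
      t.card := by
  have hinj : Function.Injective (Sym2.map (fun v : (V : Set α) => (v : α))) :=
    Sym2.map.injective Subtype.val_injective
  rw [Nat.card_coe_set_eq, ← Set.ncard_image_of_injective _ hinj, ← Set.ncard_coe_finset]
  congr 1
  ext e
  induction e using Sym2.ind with | _ a b
  constructor
  · rintro ⟨e', he', heq⟩
    induction e' using Sym2.ind with | _ c d
    rw [← heq]
    simp only [SimpleGraph.mem_edgeSet, SimpleGraph.comap_adj, Function.Embedding.subtype_apply,
      SimpleGraph.fromEdgeSet_adj] at he'
    exact he'.1
  · intro hab
    obtain ⟨ha, hb⟩ := hw a b hab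
    refine ⟨s(⟨a, ha⟩, ⟨b, hb⟩), ?_, rfl⟩
    simp only [SimpleGraph.mem_edgeSet, SimpleGraph.comap_adj, Function.Embedding.subtype_apply,
      SimpleGraph.fromEdgeSet_adj]
    exact ⟨hab, fun h => hl _ hab (by simpa using h)⟩

theorem isTree_induce_iff (hw : Within V t) (hl : ∀ e ∈ t, ¬ e.IsDiag) {τ : Fin 3 → α}
    (hτ : ∀ i, τ i ∈ V) :
    ((SimpleGraph.fromEdgeSet (t : Set (Sym2 α))).induce (V : Set α)).IsTree ↔
      HasType V t τ .conn := by
  have : Finite (V : Set α) := V.finite_toSet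
  rw [SimpleGraph.isTree_iff_connected_and_card, connected_induce_iff ⟨_, hτ 0⟩ hw,
    card_edgeSet_induce hw hl]
  have hc : Nat.card (V : Set α) = V.card := by simp
  rw [hc]
  constructor
  · rintro ⟨h, hcard⟩
    refine ⟨fun f hf h0 v hv => (h f hf v hv _ (hτ 0)).trans (h0 0), fun x y z => ?_, hcard⟩
    simp only [BType.resp, Bool.and_eq_true, beq_iff_eq]
    constructor
    · rintro ⟨rfl, rfl⟩
      exact ⟨_, Cut.const t x, rfl, rfl, rfl⟩
    · rintro ⟨f, hf, rfl, rfl, rfl⟩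
      exact ⟨h f hf _ (hτ 0) _ (hτ 1), h f hf _ (hτ 1) _ (hτ 2)⟩
  · intro h
    refine ⟨fun f hf => ?_, h.card⟩
    have hr := h.boundary.resp_self hf
    simp only [BType.resp, Bool.and_eq_true, beq_iff_eq] at hr
    have key : ∀ u ∈ V, f u = f (τ 0) := fun u hu => by
      have := h.good _ (hf.xor (Cut.const t (f (τ 0)))) (fun i => by
        fin_cases i <;> simp [← hr.1, ← hr.2]) u hu
      simpa using this
    exact fun u hu v hv => (key u hu).trans (key v hv).symm

end Tree

/-! ### The Sierpiński graphs as glued pieces, with the recursion started from a triangle at level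
`0`. -/

section Geometry

/-- The outmost vertices of `Γ_n`. -/
def corner (n : ℕ) : Fin 3 → Pt := ![(0, 0), (2 ^ n, 0), (0, 2 ^ n)]

/-- The vertices of `Γ_n`, where `Γ_0` is a triangle. -/
def triVerts : ℕ → Finset Pt
  | 0 => Finset.univ.image (corner 0)
  | n + 1 => Finset.univ.biUnion fun i => (triVerts n).image (fun p => p + corner n i)

/-- The edges of `Γ_n`, where `Γ_0` is a triangle. -/
def triEdges : ℕ → Finset (Sym2 Pt)
  | 0 => Finset.univ.image (oppEdge (corner 0))
  | n + 1 => Finset.univ.biUnion fun i => (triEdges n).image (shiftEdge (corner n i))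

theorem shift_injective (v : Pt) : Function.Injective (fun p : Pt => p + v) :=
  fun _ _ h => add_right_cancel h

theorem corner_zero_index (n : ℕ) : corner n 0 = 0 := rfl

theorem shiftEdge_zero (e : Sym2 Pt) : shiftEdge 0 e = e := by
  simp [shiftEdge]

theorem univ_biUnion_three {β : Type*} [DecidableEq β] (f : Fin 3 → Finset β) :
    Finset.univ.biUnion f = f 0 ∪ f 1 ∪ f 2 := by
  ext x
  simp [Fin.exists_fin_succ]

theorem verts_eq (n : ℕ) : verts (n + 1) = triVerts (n + 1) := by
  induction n with
  | zero => decide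
  | succ n ih =>
    rw [triVerts, univ_biUnion_three, ← ih, verts, corner_zero_index]
    simp [corner]

theorem labelledEdges_add_two (w : EdgeLabel) (n : ℕ) : labelledEdges w (n + 2) =
    Finset.univ.biUnion fun i =>
      (labelledEdges w (n + 1)).image (shiftEdge (corner (n + 1) i)) := by
  rw [univ_biUnion_three, labelledEdges, corner_zero_index]
  simp [corner, funext shiftEdge_zero]

theorem edges_eq (n : ℕ) : edges (n + 1) = triEdges (n + 1) := by
  induction n with
  | zero => decide
  | succ n ih =>
    rw [triEdges, ← ih, edges, edges]
    simp only [labelledEdges_add_two]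
    ext e
    simp only [Finset.mem_union, Finset.mem_biUnion, Finset.mem_image, Finset.mem_univ, true_and]
    grind

theorem corner_mem (n : ℕ) (i : Fin 3) : corner n i ∈ triVerts n := by
  induction n with
  | zero => exact Finset.mem_image_of_mem _ (Finset.mem_univ i)
  | succ n ih =>
    refine Finset.mem_biUnion.2 ⟨i, Finset.mem_univ i, Finset.mem_image.2 ⟨_, ih, ?_⟩⟩
    fin_cases i <;> simp [corner, pow_succ, mul_two]

theorem add_le_of_mem_triVerts (n : ℕ) : ∀ p ∈ triVerts n, p.1 + p.2 ≤ 2 ^ n := by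
  induction n with
  | zero => decide
  | succ n ih =>
    intro p hp
    obtain ⟨i, -, hp⟩ := Finset.mem_biUnion.1 hp
    obtain ⟨q, hq, rfl⟩ := Finset.mem_image.1 hp
    have := ih q hq
    rw [pow_succ]
    fin_cases i <;> simp [corner] <;> omega

theorem corner_add_corner_self (n : ℕ) (i : Fin 3) : corner n i + corner n i = corner (n + 1) i := by
  fin_cases i <;> simp [corner, pow_succ, mul_two]

theorem within_triEdges (n : ℕ) : Within (triVerts n) (triEdges n) := by
  induction n with
  | zero =>
    intro u v huv
    obtain ⟨i, -, heq⟩ := Finset.mem_image.1 huv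
    have := corner_mem 0
    rcases Sym2.eq_iff.1 heq with ⟨rfl, rfl⟩ | ⟨rfl, rfl⟩ <;> exact ⟨this _, this _⟩
  | succ n ih =>
    intro u v huv
    obtain ⟨i, -, hp⟩ := Finset.mem_biUnion.1 huv
    obtain ⟨e, he, heq⟩ := Finset.mem_image.1 hp
    induction e using Sym2.ind with | _ a b
    obtain ⟨ha, hb⟩ := ih a b he
    have key : ∀ a ∈ triVerts n, a + corner n i ∈ triVerts (n + 1) := fun a ha =>
      Finset.mem_biUnion.2 ⟨i, Finset.mem_univ i, Finset.mem_image_of_mem _ ha⟩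
    rcases Sym2.eq_iff.1 heq with ⟨rfl, rfl⟩ | ⟨rfl, rfl⟩
    · exact ⟨key _ ha, key _ hb⟩
    · exact ⟨key _ hb, key _ ha⟩

theorem not_isDiag_of_mem_triEdges (n : ℕ) : ∀ e ∈ triEdges n, ¬ e.IsDiag := by
  induction n with
  | zero => decide
  | succ n ih =>
    intro e he
    obtain ⟨i, -, hp⟩ := Finset.mem_biUnion.1 he
    obtain ⟨e', he', rfl⟩ := Finset.mem_image.1 hp
    have := ih e' he'
    rwa [shiftEdge, Sym2.isDiag_map (shift_injective _)]

theorem Within.image {α β : Type*} [DecidableEq β] {V : Finset α} {t : Finset (Sym2 α)}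
    (h : Within V t) (φ : α → β) : Within (V.image φ) (t.image (Sym2.map φ)) := by
  intro u v huv
  obtain ⟨e, he, heq⟩ := Finset.mem_image.1 huv
  induction e using Sym2.ind with | _ a b
  obtain ⟨ha, hb⟩ := h a b he
  rcases Sym2.eq_iff.1 heq with ⟨rfl, rfl⟩ | ⟨rfl, rfl⟩
  · exact ⟨Finset.mem_image_of_mem _ ha, Finset.mem_image_of_mem _ hb⟩
  · exact ⟨Finset.mem_image_of_mem _ hb, Finset.mem_image_of_mem _ ha⟩

theorem isGlue_triVerts (n : ℕ) : IsGlue (triVerts (n + 1))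
    (fun i => (triVerts n).image (fun p => p + corner n i))
    (fun i j => corner n j + corner n i) := by
  have hpos : 0 < 2 ^ n := by positivity
  have hinter : ∀ i j, i ≠ j → ∀ v ∈ (triVerts n).image (fun p => p + corner n i),
      v ∈ (triVerts n).image (fun p => p + corner n j) → v = corner n j + corner n i := by
    intro i j hij v hv hv'
    obtain ⟨p, hp, rfl⟩ := Finset.mem_image.1 hv
    obtain ⟨q, hq, heq⟩ := Finset.mem_image.1 hv'
    have hp' := add_le_of_mem_triVerts n p hp
    have hq' := add_le_of_mem_triVerts n q hq
    obtain ⟨p1, p2⟩ := p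
    obtain ⟨q1, q2⟩ := q
    -- Each copy lies in a translate of the triangle `x + y ≤ 2 ^ n`, and two such translates touch
    -- only at the junction.
    fin_cases i <;> fin_cases j <;> simp [corner] at hij heq hp' hq' ⊢ <;> omega
  have hmem : ∀ i j, corner n j + corner n i ∈ (triVerts n).image (fun p => p + corner n i) :=
    fun i j => Finset.mem_image_of_mem (fun p => p + corner n i) (corner_mem n j)
  refine ⟨fun i j => add_comm _ _, hmem, hinter, fun v => by simp [triVerts], ?_⟩
  set W := fun i => (triVerts n).image (fun p => p + corner n i)
  have h01 : W 0 ∩ W 1 = {corner n 1 + corner n 0} := by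
    ext v
    rw [Finset.mem_inter, Finset.mem_singleton]
    constructor
    · exact fun h => hinter 0 1 (by decide) v h.1 h.2
    · rintro rfl
      exact ⟨hmem 0 1, add_comm (corner n 0) (corner n 1) ▸ hmem 1 0⟩
  have h2 : (W 0 ∪ W 1) ∩ W 2 = {corner n 2 + corner n 0, corner n 2 + corner n 1} := by
    ext v
    rw [Finset.mem_inter, Finset.mem_insert, Finset.mem_singleton, Finset.mem_union]
    constructor
    · rintro ⟨h | h, h'⟩
      · exact Or.inl (hinter 0 2 (by decide) v h h')
      · exact Or.inr (hinter 1 2 (by decide) v h h')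
    · rintro (rfl | rfl)
      · exact ⟨Or.inl (hmem 0 2), add_comm (corner n 0) (corner n 2) ▸ hmem 2 0⟩
      · exact ⟨Or.inr (hmem 1 2), add_comm (corner n 1) (corner n 2) ▸ hmem 2 1⟩
  have hV : triVerts (n + 1) = (W 0 ∪ W 1) ∪ W 2 := by rw [triVerts, univ_biUnion_three]
  have c1 := Finset.card_union_add_card_inter (W 0) (W 1)
  have c2 := Finset.card_union_add_card_inter (W 0 ∪ W 1) (W 2)
  rw [h01, Finset.card_singleton] at c1
  rw [h2, Finset.card_pair (by simp [corner, hpos.ne])] at c2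
  rw [hV, Fin.sum_univ_three]
  change _ = (W 0).card + (W 1).card + (W 2).card
  omega

/-- Two copies share a single vertex, so a common edge would be a loop. -/
theorem disjoint_shift_triEdges (n : ℕ) (i j : Fin 3) (hij : i ≠ j) :
    Disjoint ((triEdges n).image (shiftEdge (corner n i)))
      ((triEdges n).image (shiftEdge (corner n j))) := by
  rw [Finset.disjoint_left]
  intro e hi hj
  have hl := not_isDiag_of_mem_triEdges (n + 1) e
    (Finset.mem_biUnion.2 ⟨i, Finset.mem_univ i, hi⟩)
  induction e using Sym2.ind with | _ u v
  have h1 := (within_triEdges n).image (fun p => p + corner n i) u v hi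
  have h2 := (within_triEdges n).image (fun p => p + corner n j) u v hj
  have hG := (isGlue_triVerts n).inter i j hij
  exact hl (Sym2.mk_isDiag_iff.2 ((hG u h1.1 h2.1).trans (hG v h1.2 h2.2).symm))

theorem forestSum_triEdges_succ {R : Type*} [CommSemiring R] (n : ℕ) (ω : Sym2 Pt → R) :
    forestSum (triVerts (n + 1)) (triEdges (n + 1)) (corner (n + 1)) ω =
      glueSum (forestSum (triVerts n) (triEdges n) (corner n) (ω ∘ shiftEdge (corner n 0)))
        (forestSum (triVerts n) (triEdges n) (corner n) (ω ∘ shiftEdge (corner n 1)))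
        (forestSum (triVerts n) (triEdges n) (corner n) (ω ∘ shiftEdge (corner n 2))) := by
  have h := (isGlue_triVerts n).forestSum_eq_glueSum
    (E := fun i => (triEdges n).image (shiftEdge (corner n i)))
    (fun i => (within_triEdges n).image _) (disjoint_shift_triEdges n) ω
  simp only [corner_add_corner_self] at h
  have key : ∀ i, forestSum ((triVerts n).image (fun p => p + corner n i))
      ((triEdges n).image (shiftEdge (corner n i))) (fun j => corner n j + corner n i) ω =
      forestSum (triVerts n) (triEdges n) (corner n) (ω ∘ shiftEdge (corner n i)) :=
    fun i => forestSum_image (shift_injective (corner n i)) _ _ _ _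
  rw [key, key, key] at h
  exact h

end Geometry

end Sierpinski

namespace Sierpinski

/-! ### The polynomial recursion and its closed form. -/

section Recursion

open Polynomial

/-- The weight `X` for the edges labelled `w`, the weight `1` for the other edges. -/
noncomputable def labelWeight (w : EdgeLabel) (n : ℕ) (e : Sym2 Pt) : ℝ[X] :=
  if e ∈ labelledEdges w n then X else 1

theorem labelledEdges_subset (w : EdgeLabel) (n : ℕ) : labelledEdges w n ⊆ edges n := by
  intro e he
  cases w <;> simp [edges, he]

theorem labelWeight_shift (w : EdgeLabel) (n : ℕ) (i : Fin 3) {e : Sym2 Pt}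
    (he : e ∈ triEdges (n + 1)) :
    labelWeight w (n + 2) (shiftEdge (corner (n + 1) i) e) = labelWeight w (n + 1) e := by
  have hiff : shiftEdge (corner (n + 1) i) e ∈ labelledEdges w (n + 2) ↔
      e ∈ labelledEdges w (n + 1) := by
    rw [labelledEdges_add_two, Finset.mem_biUnion]
    constructor
    · rintro ⟨j, -, hj⟩
      by_cases hij : i = j
      · subst hij
        exact ((Sym2.map.injective (shift_injective _)).mem_finset_image).1 hj
      · have hj' := Finset.image_subset_image
          ((labelledEdges_subset w (n + 1)).trans (edges_eq n).subset) hj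
        exact absurd hj' (Finset.disjoint_left.1 (disjoint_shift_triEdges (n + 1) i j hij)
          (Finset.mem_image_of_mem _ he))
    · exact fun h => ⟨i, Finset.mem_univ i, Finset.mem_image_of_mem _ h⟩
  simp only [labelWeight, hiff]

/-- The generating functions, with respect to the number of edges labelled `w`, of the spanning
forests of `Γ_n`. -/
noncomputable def labelSum (w : EdgeLabel) (n : ℕ) : BType → ℝ[X] :=
  forestSum (triVerts n) (triEdges n) (corner n) (labelWeight w n)

theorem labelSum_add_two (w : EdgeLabel) (n : ℕ) : labelSum w (n + 2) =
    glueSum (labelSum w (n + 1)) (labelSum w (n + 1)) (labelSum w (n + 1)) := by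
  have key : ∀ i, forestSum (triVerts (n + 1)) (triEdges (n + 1)) (corner (n + 1))
      (labelWeight w (n + 2) ∘ shiftEdge (corner (n + 1) i)) = labelSum w (n + 1) := fun i =>
    funext fun π => forestSum_congr (fun e he => labelWeight_shift w n i he) π
  rw [labelSum, forestSum_triEdges_succ, key, key, key]

/-- The relations between the generating functions of a graph with three equivalent terminals. -/
structure Isotropic {R : Type*} [CommSemiring R] (F : BType → R) : Prop where
  iso_eq : ∀ i, F (.iso i) = F (.iso 0)
  conn_mul_sep : F .conn * F .sep = 3 * F (.iso 0) ^ 2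

theorem Isotropic.glueSum_conn {R : Type*} [CommSemiring R] {F : BType → R} (h : Isotropic F) :
    glueSum F F F .conn = 6 * F .conn ^ 2 * F (.iso 0) := by
  simp only [glueSum, glueList, List.map_cons, List.map_nil, List.sum_cons, List.sum_nil,
    h.iso_eq 1, h.iso_eq 2]
  ring

/-- Of the eight gluings, seven contribute `T F²` and one contributes `T² S`, which equals `3 T F²`
by the isotropy relation. -/
theorem Isotropic.glueSum_iso {R : Type*} [CommSemiring R] {F : BType → R} (h : Isotropic F)
    (i : Fin 3) : glueSum F F F (.iso i) = 10 * F .conn * F (.iso 0) ^ 2 := by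
  have : glueSum F F F (.iso i) =
      7 * F .conn * F (.iso 0) ^ 2 + F .conn * (F .conn * F .sep) := by
    fin_cases i <;>
      simp [glueSum, glueList, h.iso_eq 1, h.iso_eq 2] <;> ring
  rw [this, h.conn_mul_sep]
  ring

theorem Isotropic.glueSum_sep {R : Type*} [CommSemiring R] {F : BType → R} (h : Isotropic F) :
    glueSum F F F .sep = 50 * F (.iso 0) ^ 3 := by
  have : glueSum F F F .sep =
      14 * F (.iso 0) ^ 3 + 12 * F (.iso 0) * (F .conn * F .sep) := by
    simp only [glueSum, glueList, List.map_cons, List.map_nil, List.sum_cons, List.sum_nil,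
      h.iso_eq 1, h.iso_eq 2]
    ring
  rw [this, h.conn_mul_sep]
  ring

/-- The relation survives because the coefficients satisfy `6 * 50 = 3 * 10 ^ 2`. -/
theorem Isotropic.glue {R : Type*} [CommSemiring R] {F : BType → R} (h : Isotropic F) :
    Isotropic (glueSum F F F) := by
  refine ⟨fun i => by rw [h.glueSum_iso, h.glueSum_iso], ?_⟩
  rw [h.glueSum_conn, h.glueSum_sep, h.glueSum_iso]
  ring

/-- The weight of the edges labelled `l`. -/
noncomputable def weightOf (w l : EdgeLabel) : ℝ[X] := if l = w then X else 1

theorem corner_zero_injective : Function.Injective (corner 0) := by decide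

theorem labelSum_one (w : EdgeLabel) : labelSum w 1 =
    glueSum (triangleSum ![weightOf w .c, weightOf w .b, weightOf w .a])
      (triangleSum ![weightOf w .a, weightOf w .c, weightOf w .b])
      (triangleSum ![weightOf w .b, weightOf w .a, weightOf w .c]) := by
  have htri : ∀ ω : Sym2 Pt → ℝ[X], forestSum (triVerts 0) (triEdges 0) (corner 0) ω =
      triangleSum (fun i => ω (oppEdge (corner 0) i)) := forestSum_triangle corner_zero_injective
  -- Row `i` of the table is the `i`-th corner triangle; its entry `k` is the label of the edge
  -- opposite to vertex `k`.
  have hmem : ∀ i k : Fin 3, ∀ l : EdgeLabel,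
      ((shiftEdge (corner 0 i) (oppEdge (corner 0) k) ∈ labelledEdges l 1) ↔
        (![![EdgeLabel.c, .b, .a], ![.a, .c, .b], ![.b, .a, .c]] i k) = l) := by
    intro i k l
    cases l <;> revert i k <;> decide
  have hw : ∀ i k : Fin 3, labelWeight w 1 (shiftEdge (corner 0 i) (oppEdge (corner 0) k)) =
      weightOf w (![![EdgeLabel.c, .b, .a], ![.a, .c, .b], ![.b, .a, .c]] i k) := fun i k => by
    simp only [labelWeight, weightOf, hmem]
  rw [labelSum, forestSum_triEdges_succ, htri, htri, htri]
  simp only [Function.comp_apply, hw]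
  congr 2 <;> funext k <;> fin_cases k <;> rfl

/-- The generating function of the spanning trees of `Γ_1`, up to a constant. -/
noncomputable def treePoly : EdgeLabel → ℝ[X]
  | .c => (2 * X + 1) ^ 2
  | _ => (2 * X + 1) ^ 2 * (X + 1)

/-- The generating function of the two-component forests of `Γ_1`, up to a constant. -/
noncomputable def forestPoly : EdgeLabel → ℝ[X]
  | .c => (2 * X + 1) * (3 * X + 2)
  | _ => (2 * X + 1) * ((X + 1) * (X + 4))

theorem isotropic_labelSum_one (w : EdgeLabel) : Isotropic (labelSum w 1) ∧
    (∃ κ : ℝ, 0 < κ ∧ labelSum w 1 .conn = C κ * treePoly w) ∧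
    (∃ κ : ℝ, 0 < κ ∧ labelSum w 1 (.iso 0) = C κ * forestPoly w) := by
  rw [labelSum_one]
  generalize ha : weightOf w .a = a
  generalize hb : weightOf w .b = b
  generalize hc : weightOf w .c = c
  have hconn : glueSum (triangleSum ![c, b, a]) (triangleSum ![a, c, b])
      (triangleSum ![b, a, c]) .conn = 3 * (a + b) * (a * b + b * c + c * a) ^ 2 := by
    simp [glueSum, glueList, triangleSum]
    ring
  have hiso : ∀ i, glueSum (triangleSum ![c, b, a]) (triangleSum ![a, c, b])
      (triangleSum ![b, a, c]) (.iso i) =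
      (a + b) * (a * b + b * c + c * a) * (a + b + 3 * c) := by
    intro i
    fin_cases i <;> simp [glueSum, glueList, triangleSum] <;> ring
  have hsep : glueSum (triangleSum ![c, b, a]) (triangleSum ![a, c, b])
      (triangleSum ![b, a, c]) .sep = (a + b) * (a + b + 3 * c) ^ 2 := by
    simp [glueSum, glueList, triangleSum]
    ring
  refine ⟨⟨fun i => by rw [hiso, hiso], by rw [hconn, hsep, hiso]; ring⟩, ?_, ?_⟩
  · rw [hconn, ← ha, ← hb, ← hc]
    cases w
    · exact ⟨3, by norm_num, by simp [weightOf, treePoly, map_ofNat C]; ring⟩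
    · exact ⟨3, by norm_num, by simp [weightOf, treePoly, map_ofNat C]; ring⟩
    · exact ⟨6, by norm_num, by simp [weightOf, treePoly, map_ofNat C]; ring⟩
  · rw [hiso, ← ha, ← hb, ← hc]
    cases w
    · exact ⟨1, by norm_num, by simp [weightOf, forestPoly]; ring⟩
    · exact ⟨1, by norm_num, by simp [weightOf, forestPoly]; ring⟩
    · exact ⟨2, by norm_num, by simp [weightOf, forestPoly, map_ofNat C]; ring⟩

theorem labelSum_eq (w : EdgeLabel) (m : ℕ) : Isotropic (labelSum w (m + 1)) ∧
    ∃ k : ℕ, 2 * k + 1 = 3 ^ m ∧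
    (∃ κ : ℝ, 0 < κ ∧
      labelSum w (m + 1) .conn = C κ * (treePoly w ^ (k + 1) * forestPoly w ^ k)) ∧
    (∃ κ : ℝ, 0 < κ ∧
      labelSum w (m + 1) (.iso 0) = C κ * (treePoly w ^ k * forestPoly w ^ (k + 1))) := by
  induction m with
  | zero =>
    obtain ⟨h, ⟨κ, hκ, h1⟩, ⟨κ', hκ', h2⟩⟩ := isotropic_labelSum_one w
    exact ⟨h, 0, by norm_num, ⟨κ, hκ, by simp [h1]⟩, ⟨κ', hκ', by simp [h2]⟩⟩
  | succ m ih =>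
    obtain ⟨h, k, hk, ⟨κ, hκ, h1⟩, ⟨κ', hκ', h2⟩⟩ := ih
    rw [labelSum_add_two]
    -- In `T² F` the exponent of `treePoly` is `2(k+1) + k = (3k+1) + 1` and that of `forestPoly` is
    -- `2k + (k+1) = 3k+1`; the roles are exchanged in `T F²`.
    refine ⟨h.glue, 3 * k + 1, by rw [pow_succ, ← hk]; ring,
      ⟨6 * κ ^ 2 * κ', by positivity, ?_⟩, ⟨10 * κ * κ' ^ 2, by positivity, ?_⟩⟩
    · rw [h.glueSum_conn, h1, h2]
      simp only [map_mul, map_pow, map_ofNat]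
      ring
    · rw [h.glueSum_iso, h1, h2]
      simp only [map_mul, map_pow, map_ofNat]
      ring

end Recursion

/-! ### The generating function of the spanning trees themselves. -/

section Trees

open Polynomial

open Classical in
/-- The finset of spanning trees of `Γ_n`. -/
noncomputable def treeFinset (n : ℕ) : Finset (Finset (Sym2 Pt)) :=
  (edges n).powerset.filter fun t => (spanningSubgraph n t).IsTree

theorem coe_treeFinset (n : ℕ) : (treeFinset n : Set (Finset (Sym2 Pt))) = spanningTrees n := by
  classical
  ext t
  simp [treeFinset, spanningTrees]

theorem mem_treeFinset_iff (m : ℕ) (t : Finset (Sym2 Pt)) : t ∈ treeFinset (m + 1) ↔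
    t ⊆ triEdges (m + 1) ∧
      HasType (triVerts (m + 1)) t (corner (m + 1)) .conn := by
  classical
  rw [treeFinset, Finset.mem_filter, Finset.mem_powerset, edges_eq]
  refine and_congr_right fun ht => ?_
  rw [← isTree_induce_iff ((within_triEdges (m + 1)).mono ht)
    (fun e he => not_isDiag_of_mem_triEdges (m + 1) e (ht he)) (corner_mem (m + 1)), ← verts_eq]
  rfl

/-- The spanning trees of `Γ_n`, counted with respect to the number of edges labelled `w`. -/
theorem sum_treeFinset (w : EdgeLabel) (m : ℕ) :
    ∃ k : ℕ, 2 * k + 1 = 3 ^ m ∧ ∃ κ : ℝ, 0 < κ ∧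
      ∑ t ∈ treeFinset (m + 1), X ^ (t ∩ labelledEdges w (m + 1)).card =
        C κ * (treePoly w ^ (k + 1) * forestPoly w ^ k) := by
  classical
  obtain ⟨-, k, hk, ⟨κ, hκ, h⟩, -⟩ := labelSum_eq w m
  refine ⟨k, hk, κ, hκ, ?_⟩
  rw [← h, labelSum, forestSum]
  refine Finset.sum_congr ?_ fun t _ => ?_
  · ext t
    simp [mem_treeFinset_iff]
  · simp [labelWeight]

end Trees

end Sierpinski

namespace Sierpinski

/-! ### Mean and variance read from a generating polynomial; both add under products. -/

section Moments

open Polynomial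

/-- `P` has the value `1`, the mean `μ` and the variance `v` of a probability generating
function. -/
structure HasMoments (P : ℝ[X]) (μ v : ℝ) : Prop where
  eval_one : P.eval 1 = 1
  eval_derivative : P.derivative.eval 1 = μ
  eval_derivative_two : P.derivative.derivative.eval 1 = v + μ ^ 2 - μ

theorem HasMoments.one : HasMoments 1 0 0 := ⟨by simp, by simp, by simp⟩

theorem HasMoments.mul {P Q : ℝ[X]} {μ v μ' v' : ℝ} (h : HasMoments P μ v)
    (h' : HasMoments Q μ' v') : HasMoments (P * Q) (μ + μ') (v + v') := by
  refine ⟨?_, ?_, ?_⟩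
  · simp [h.eval_one, h'.eval_one]
  · simp [derivative_mul, h.eval_one, h'.eval_one, h.eval_derivative, h'.eval_derivative]
  · simp [derivative_mul, h.eval_one, h'.eval_one, h.eval_derivative, h'.eval_derivative,
      h.eval_derivative_two, h'.eval_derivative_two]
    ring

theorem HasMoments.pow {P : ℝ[X]} {μ v : ℝ} (h : HasMoments P μ v) (m : ℕ) :
    HasMoments (P ^ m) (m * μ) (m * v) := by
  induction m with
  | zero => simpa using HasMoments.one
  | succ m ih =>
    have := ih.mul h
    rw [pow_succ]
    convert this using 1 <;> push_cast <;> ring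

theorem HasMoments.prod {ι : Type*} (s : Finset ι) {P : ι → ℝ[X]} {μ v : ι → ℝ}
    (h : ∀ i, HasMoments (P i) (μ i) (v i)) :
    HasMoments (∏ i ∈ s, P i) (∑ i ∈ s, μ i) (∑ i ∈ s, v i) := by
  classical
  induction s using Finset.induction_on with
  | empty => simpa using HasMoments.one
  | insert i s hi ih =>
    rw [Finset.prod_insert hi, Finset.sum_insert hi, Finset.sum_insert hi]
    exact (h i).mul ih

/-- The probability generating function of a sum of independent Bernoulli variables, `m i` of
which have the parameter `p i`. -/
noncomputable def bernoulliPoly {ι : Type*} [Fintype ι] (p : ι → ℝ) (m : ι → ℕ) : ℝ[X] :=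
  ∏ i, (C (1 - p i) + C (p i) * X) ^ m i

theorem hasMoments_bernoulliPoly {ι : Type*} [Fintype ι] (p : ι → ℝ) (m : ι → ℕ) :
    HasMoments (bernoulliPoly p m) (∑ i, m i * p i) (∑ i, m i * (p i * (1 - p i))) :=
  HasMoments.prod _ fun i => HasMoments.pow ⟨by simp, by simp, by simp; ring⟩ _

end Moments

/-! ### The central limit theorem for Bernoulli sums at complex arguments. -/

section Limit

open Complex Asymptotics

/-- On the ball of radius `‖s‖` the derivative is at most `c * ‖s‖`, so the mean value inequality
bounds `g s` by `c * ‖s‖ ^ 2`. -/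
theorem isLittleO_sq_of_deriv {g g' : ℂ → ℂ} (h0 : g 0 = 0)
    (hg : ∀ᶠ s in 𝓝 0, HasDerivAt g (g' s) s) (hg' : g' =o[𝓝 0] fun s => s) :
    g =o[𝓝 0] fun s => s ^ 2 := by
  rw [isLittleO_iff]
  intro c hc
  obtain ⟨δ, hδ, hball⟩ := Metric.eventually_nhds_iff_ball.1 (hg.and (isLittleO_iff.1 hg' hc))
  refine Metric.eventually_nhds_iff_ball.2 ⟨δ, hδ, fun s hs => ?_⟩
  have hsub : Metric.closedBall (0 : ℂ) ‖s‖ ⊆ Metric.ball 0 δ :=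
    Metric.closedBall_subset_ball (by simpa using hs)
  have := (convex_closedBall (0 : ℂ) ‖s‖).norm_image_sub_le_of_norm_hasDerivWithin_le
    (f := g) (f' := g') (C := c * ‖s‖) (x := 0) (y := s)
    (fun x hx => (hball x (hsub hx)).1.hasDerivWithinAt)
    (fun x hx => (hball x (hsub hx)).2.trans
      (mul_le_mul_of_nonneg_left (by simpa using hx) hc.le))
    (by simp) (by simp)
  simpa [h0, pow_two, mul_assoc] using this

/-- The error term in the second order expansion of the cumulant generating function of a
Bernoulli variable. -/
noncomputable def cumulantError (p : ℝ) (s : ℂ) : ℂ :=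
  log (1 - p + p * exp s) - p * s - p * (1 - p) * s ^ 2 / 2

theorem cumulantError_isLittleO (p : ℝ) : cumulantError p =o[𝓝 0] fun s => s ^ 2 := by
  have hcont : Continuous fun s : ℂ => 1 - (p : ℂ) + p * exp s := by fun_prop
  have hslit : ∀ᶠ s : ℂ in 𝓝 0, 1 - (p : ℂ) + p * exp s ∈ slitPlane :=
    hcont.continuousAt.eventually (isOpen_slitPlane.mem_nhds (by simp))
  have hd : ∀ s, HasDerivAt (fun s : ℂ => 1 - (p : ℂ) + p * exp s) (p * exp s) s := fun s =>
    ((hasDerivAt_exp s).const_mul (p : ℂ)).const_add _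
  refine isLittleO_sq_of_deriv
    (g' := fun s => p * exp s / (1 - p + p * exp s) - p - p * (1 - p) * s) ?_ ?_ ?_
  · simp [cumulantError]
  · filter_upwards [hslit] with s hs
    have h1 := (hd s).clog hs
    have h2 := ((h1.sub ((hasDerivAt_id s).const_mul (p : ℂ)))).sub
      ((((hasDerivAt_id s).pow 2).const_mul ((p : ℂ) * (1 - p))).div_const 2)
    refine (h2.congr_deriv ?_)
    simp
    ring
  · have h1 : HasDerivAt (fun s : ℂ => p * exp s / (1 - p + p * exp s) - p - p * (1 - p) * s)
        0 0 := by
      have := ((((hasDerivAt_exp 0).const_mul (p : ℂ)).div (hd 0) (by simp)).sub_const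
        (p : ℂ)).sub ((hasDerivAt_id (0 : ℂ)).const_mul ((p : ℂ) * (1 - p)))
      refine this.congr_deriv ?_
      simp
      ring
    have := h1.isLittleO
    simpa using this

theorem bernoulli_eq_exp (p : ℝ) {s : ℂ} (hs : 1 - (p : ℂ) + p * exp s ≠ 0) :
    1 - (p : ℂ) + p * exp s = exp (p * s + p * (1 - p) * s ^ 2 / 2 + cumulantError p s) := by
  rw [cumulantError]
  conv_lhs => rw [← exp_log hs]
  congr 1
  ring

variable {ι : Type*} [Fintype ι]

/-- The central limit theorem for sums of independent Bernoulli variables, in terms of the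
complex moment generating function. -/
theorem tendsto_bernoulli_mgf (p : ι → ℝ) (hp : ∀ i, 0 < p i ∧ p i < 1) (m : ℕ → ι → ℕ)
    (V : ℕ → ℝ) (hV : ∀ n, V n = ∑ i, m n i * (p i * (1 - p i))) (hVt : Tendsto V atTop atTop)
    (z : ℂ) :
    Tendsto (fun n => exp (-(z / (√(V n) : ℝ)) * (∑ i, m n i * p i : ℝ)) *
      ∏ i, (1 - (p i : ℂ) + p i * exp (z / (√(V n) : ℝ))) ^ m n i) atTop
      (𝓝 (exp (z ^ 2 / 2))) := by
  set s : ℕ → ℂ := fun n => z / (√(V n) : ℝ) with hs_def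
  have hs : Tendsto s atTop (𝓝 0) := by
    have h1 : Tendsto (fun n => (√(V n))⁻¹) atTop (𝓝 0) :=
      (Real.tendsto_sqrt_atTop.comp hVt).inv_tendsto_atTop
    have h2 := ((continuous_ofReal.tendsto 0).comp h1).const_mul z
    simpa [hs_def, div_eq_mul_inv, Function.comp_def] using h2
  have hpos : ∀ᶠ n in atTop, 0 < V n := hVt.eventually_gt_atTop 0
  have hne : ∀ᶠ n in atTop, ∀ i, 1 - (p i : ℂ) + p i * exp (s n) ≠ 0 := by
    rw [eventually_all]
    intro i
    have hcont : Continuous fun s : ℂ => 1 - (p i : ℂ) + p i * exp s := by fun_prop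
    exact hs.eventually (hcont.continuousAt.eventually_ne (by simp))
  have hsq : ∀ᶠ n in atTop, (V n : ℂ) * s n ^ 2 = z ^ 2 := by
    filter_upwards [hpos] with n hn
    have h1 : ((√(V n) : ℝ) : ℂ) ^ 2 = V n := by
      rw [← ofReal_pow, Real.sq_sqrt hn.le]
    have h2 : (V n : ℂ) ≠ 0 := by exact_mod_cast hn.ne'
    rw [hs_def, div_pow, h1]
    field_simp
  -- Every `p i` is strictly between `0` and `1`, so `m n i = O(V n)`, while the error is `o(s²)`
  -- and `V n * s² = z²` is constant.
  have herr : ∀ i, Tendsto (fun n => (m n i : ℂ) * cumulantError (p i) (s n)) atTop (𝓝 0) := by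
    intro i
    have hv : 0 < p i * (1 - p i) := mul_pos (hp i).1 (by linarith [(hp i).2])
    have h1 := (cumulantError_isLittleO (p i)).comp_tendsto hs
    have h2 : (fun n => (m n i : ℂ)) =O[atTop] fun n => (V n : ℂ) := by
      refine IsBigO.of_bound (p i * (1 - p i))⁻¹ ?_
      filter_upwards [hpos] with n hn
      rw [Complex.norm_natCast, Complex.norm_of_nonneg hn.le, inv_mul_eq_div, le_div_iff₀ hv, hV]
      exact Finset.single_le_sum (f := fun i => (m n i : ℝ) * (p i * (1 - p i)))
        (fun j _ => mul_nonneg (by positivity)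
          (mul_nonneg (hp j).1.le (by linarith [(hp j).2]))) (Finset.mem_univ i)
    have h3 := h2.mul_isLittleO h1
    have h4 : (fun n => (V n : ℂ) * s n ^ 2) =ᶠ[atTop] fun _ => z ^ 2 := hsq
    exact (isLittleO_one_iff ℂ).1 ((h3.trans_eventuallyEq h4).trans_isBigO
      (isBigO_const_const _ one_ne_zero _))
  have hsum : Tendsto (fun n => z ^ 2 / 2 + ∑ i, (m n i : ℂ) * cumulantError (p i) (s n)) atTop
      (𝓝 (z ^ 2 / 2 + ∑ _i : ι, (0 : ℂ))) :=
    (tendsto_finsetSum _ fun i _ => herr i).const_add _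
  rw [Finset.sum_const_zero, add_zero] at hsum
  refine ((continuous_exp.tendsto _).comp hsum).congr' ?_
  filter_upwards [hpos, hne, hsq] with n hn hnen hsqn
  have hV' : (V n : ℂ) = ∑ i, (m n i : ℂ) * (p i * (1 - p i)) := by
    rw [hV n]; push_cast; rfl
  simp only [Function.comp_apply]
  rw [Finset.prod_congr rfl fun i _ => by rw [bernoulli_eq_exp (p i) (hnen i), ← exp_nat_mul],
    ← exp_sum, ← exp_add]
  congr 1
  rw [← hsqn, hV', Finset.sum_mul, Finset.sum_div, ofReal_sum, Finset.mul_sum,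
    ← Finset.sum_add_distrib, ← Finset.sum_add_distrib]
  refine Finset.sum_congr rfl fun i _ => ?_
  push_cast
  ring

end Limit

end Sierpinski

namespace Sierpinski

section Uniform

variable {Ω : Type*} [MeasurableSpace Ω] [MeasurableSingletonClass Ω]

theorem integral_uniformOn_finset {E : Type*} [NormedAddCommGroup E] [NormedSpace ℝ E]
    [CompleteSpace E] (s : Finset Ω) (f : Ω → E) :
    ∫ t, f t ∂(uniformOn (s : Set Ω)) = (s.card : ℝ)⁻¹ • ∑ t ∈ s, f t := by
  have hint : IntegrableOn f (s : Set Ω) Measure.count := by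
    rw [← (s : Set Ω).biUnion_of_singleton]
    simp [integrableOn_finset_iUnion]
  rw [uniformOn, ProbabilityTheory.cond, integral_smul_measure, Measure.count_apply_finset,
    setIntegral_finset s hint]
  simp [Measure.real]

end Uniform

/-! ### The label count as a sum of independent Bernoulli variables. -/

section Law

open Polynomial

/-- The parameters of the Bernoulli variables whose sum has the law of the number of edges
labelled `w`. -/
noncomputable def labelParam : EdgeLabel → Fin 3 → ℝ
  | .c => ![2 / 3, 1 / 2, 3 / 5]
  | _ => ![2 / 3, 1 / 2, 1 / 5]

/-- The numbers of Bernoulli variables with the parameters `labelParam w` for the graph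
`Γ_{m + 1}`. -/
def labelMult (w : EdgeLabel) (m : ℕ) : Fin 3 → ℕ :=
  match w with
  -- Only two parameters occur for `c`; multiplicity `0` makes the middle one a filler.
  | .c => ![3 * ((3 ^ m - 1) / 2) + 2, 0, (3 ^ m - 1) / 2]
  | _ => ![3 * ((3 ^ m - 1) / 2) + 2, 2 * ((3 ^ m - 1) / 2) + 1, (3 ^ m - 1) / 2]

theorem labelParam_mem (w : EdgeLabel) (i : Fin 3) : 0 < labelParam w i ∧ labelParam w i < 1 := by
  cases w <;> fin_cases i <;> norm_num [labelParam]

theorem exists_treePoly_eq (w : EdgeLabel) (m k : ℕ) (hk : 2 * k + 1 = 3 ^ m) :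
    ∃ κ : ℝ, 0 < κ ∧ treePoly w ^ (k + 1) * forestPoly w ^ k =
      C κ * bernoulliPoly (labelParam w) (labelMult w m) := by
  obtain rfl : k = (3 ^ m - 1) / 2 := by omega
  set k := (3 ^ m - 1) / 2 with hk_def
  have e1 : (2 * X + 1 : ℝ[X]) = C 3 * (C (1 - 2 / 3) + C (2 / 3) * X) := by
    rw [mul_add, ← mul_assoc, ← C_mul, ← C_mul]
    norm_num [map_ofNat C]
    ring
  have e2 : (X + 1 : ℝ[X]) = C 2 * (C (1 - 1 / 2) + C (1 / 2) * X) := by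
    rw [mul_add, ← mul_assoc, ← C_mul, ← C_mul]
    norm_num
    ring
  have e3 : (X + 4 : ℝ[X]) = C 5 * (C (1 - 1 / 5) + C (1 / 5) * X) := by
    rw [mul_add, ← mul_assoc, ← C_mul, ← C_mul]
    norm_num [map_ofNat C]
    ring
  have e4 : (3 * X + 2 : ℝ[X]) = C 5 * (C (1 - 3 / 5) + C (3 / 5) * X) := by
    rw [mul_add, ← mul_assoc, ← C_mul, ← C_mul]
    norm_num [map_ofNat C]
    ring
  cases w
  -- The constant is the value at `X = 1`: the factors `2X+1`, `X+1`, `X+4` take the values `3`,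
  -- `2`, `5` and occur `3k+2`, `2k+1`, `k` times.
  · refine ⟨3 ^ (3 * k + 2) * 2 ^ (2 * k + 1) * 5 ^ k, by positivity, ?_⟩
    simp only [treePoly, forestPoly, e1, e2, e3, bernoulliPoly, labelParam, labelMult,
      Fin.prod_univ_three, ← hk_def, map_mul, map_pow, Matrix.cons_val]
    generalize (C (1 - 2 / 3) + C (2 / 3) * X : ℝ[X]) = A
    generalize (C (1 - 1 / 2) + C (1 / 2) * X : ℝ[X]) = B
    generalize (C (1 - 1 / 5) + C (1 / 5) * X : ℝ[X]) = D
    ring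
  · refine ⟨3 ^ (3 * k + 2) * 2 ^ (2 * k + 1) * 5 ^ k, by positivity, ?_⟩
    simp only [treePoly, forestPoly, e1, e2, e3, bernoulliPoly, labelParam, labelMult,
      Fin.prod_univ_three, ← hk_def, map_mul, map_pow, Matrix.cons_val]
    generalize (C (1 - 2 / 3) + C (2 / 3) * X : ℝ[X]) = A
    generalize (C (1 - 1 / 2) + C (1 / 2) * X : ℝ[X]) = B
    generalize (C (1 - 1 / 5) + C (1 / 5) * X : ℝ[X]) = D
    ring
  · refine ⟨3 ^ (3 * k + 2) * 5 ^ k, by positivity, ?_⟩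
    simp only [treePoly, forestPoly, e1, e4, bernoulliPoly, labelParam, labelMult,
      Fin.prod_univ_three, ← hk_def, map_mul, map_pow, Matrix.cons_val]
    generalize (C (1 - 2 / 3) + C (2 / 3) * X : ℝ[X]) = A
    generalize (C (1 - 3 / 5) + C (3 / 5) * X : ℝ[X]) = D
    ring

/-- The number of edges labelled `w` in a uniformly random spanning tree has the law of a sum of
independent Bernoulli variables. -/
theorem sum_treeFinset_eq (w : EdgeLabel) (m : ℕ) :
    0 < (treeFinset (m + 1)).card ∧
    ∑ t ∈ treeFinset (m + 1), X ^ (t ∩ labelledEdges w (m + 1)).card =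
      C ((treeFinset (m + 1)).card : ℝ) * bernoulliPoly (labelParam w) (labelMult w m) := by
  obtain ⟨k, hk, κ, hκ, h⟩ := sum_treeFinset w m
  obtain ⟨κ', hκ', h'⟩ := exists_treePoly_eq w m k hk
  rw [h', ← mul_assoc, ← C_mul] at h
  -- At `X = 1` the left side counts the trees and the Bernoulli polynomial equals `1`, so the
  -- constant is the number of trees, which is therefore positive.
  have h1 := congrArg (Polynomial.eval 1) h
  rw [eval_mul, (hasMoments_bernoulliPoly _ _).eval_one, eval_finsetSum] at h1
  simp only [eval_pow, eval_X, one_pow, Finset.sum_const, nsmul_eq_mul, mul_one, eval_C] at h1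
  rw [h, h1]
  refine ⟨?_, rfl⟩
  have : (0 : ℝ) < (treeFinset (m + 1)).card := h1 ▸ mul_pos hκ hκ'
  exact_mod_cast this

theorem ust_eq (n : ℕ) : ust n = uniformOn (treeFinset n : Set (Finset (Sym2 Pt))) := by
  rw [ust, coe_treeFinset]

theorem integral_ust {E : Type*} [NormedAddCommGroup E] [NormedSpace ℝ E] [CompleteSpace E]
    (n : ℕ) (f : Finset (Sym2 Pt) → E) :
    ∫ t, f t ∂(ust n) = ((treeFinset n).card : ℝ)⁻¹ • ∑ t ∈ treeFinset n, f t := by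
  rw [ust_eq, integral_uniformOn_finset]

theorem isProbabilityMeasure_ust (m : ℕ) : IsProbabilityMeasure (ust (m + 1)) := by
  rw [ust_eq]
  exact isProbabilityMeasure_uniformOn (Finset.finite_toSet _)
    (Finset.card_pos.1 (sum_treeFinset_eq .a m).1)

theorem meanCount_eq (w : EdgeLabel) (m : ℕ) :
    meanCount (m + 1) w = ∑ i, labelMult w m i * labelParam w i := by
  obtain ⟨hpos, h⟩ := sum_treeFinset_eq w m
  have hne : ((treeFinset (m + 1)).card : ℝ) ≠ 0 := by exact_mod_cast hpos.ne'
  have h1 := congrArg (fun P => Polynomial.eval 1 (derivative P)) h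
  simp only [derivative_sum, derivative_X_pow, eval_finsetSum, derivative_C_mul, eval_mul,
    eval_C, eval_pow, eval_X, one_pow, mul_one, (hasMoments_bernoulliPoly _ _).eval_derivative]
    at h1
  rw [meanCount, integral_ust, smul_eq_mul]
  simp only [labelCount]
  rw [h1, inv_mul_cancel_left₀ hne]

theorem varCount_eq (w : EdgeLabel) (m : ℕ) :
    varCount (m + 1) w = ∑ i, labelMult w m i * (labelParam w i * (1 - labelParam w i)) := by
  obtain ⟨hpos, h⟩ := sum_treeFinset_eq w m
  have hne : ((treeFinset (m + 1)).card : ℝ) ≠ 0 := by exact_mod_cast hpos.ne'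
  -- The second derivative at `1` gives the factorial moment `E[N(N-1)]`, from which the variance
  -- follows using the mean.
  have h2 := congrArg (fun P => Polynomial.eval 1 (derivative (derivative P))) h
  have hcast : ∀ c : ℕ, (c : ℝ) * ((c - 1 : ℕ) : ℝ) = (c : ℝ) ^ 2 - c := by
    intro c
    cases c
    · simp
    · rw [Nat.add_sub_cancel]
      push_cast
      ring
  simp only [derivative_sum, derivative_X_pow, eval_finsetSum, derivative_C_mul, eval_mul,
    eval_C, eval_pow, eval_X, one_pow, mul_one, (hasMoments_bernoulliPoly _ _).eval_derivative_two,
    hcast, Finset.sum_sub_distrib] at h2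
  have h1 := meanCount_eq w m
  rw [meanCount, integral_ust, smul_eq_mul, inv_mul_eq_iff_eq_mul₀ hne] at h1
  simp only [labelCount] at h1
  rw [varCount, variance_eq_integral Measurable.of_discrete.aemeasurable, integral_ust,
    smul_eq_mul]
  change _ * ∑ t ∈ _, (labelCount (m + 1) w t - meanCount (m + 1) w) ^ 2 = _
  simp only [sub_sq, Finset.sum_add_distrib, Finset.sum_sub_distrib, Finset.sum_const,
    nsmul_eq_mul, ← Finset.mul_sum, ← Finset.sum_mul, labelCount, meanCount_eq]
  rw [inv_mul_eq_iff_eq_mul₀ hne, h1]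
  rw [h1] at h2
  linear_combination h2

theorem integral_pow_labelCount (w : EdgeLabel) (m : ℕ) (z : ℂ) :
    ∫ t, z ^ (t ∩ labelledEdges w (m + 1)).card ∂(ust (m + 1)) =
      ∏ i, (1 - (labelParam w i : ℂ) + labelParam w i * z) ^ labelMult w m i := by
  obtain ⟨hpos, h⟩ := sum_treeFinset_eq w m
  have hne : ((treeFinset (m + 1)).card : ℂ) ≠ 0 := by exact_mod_cast hpos.ne'
  have h1 := congrArg (Polynomial.aeval z) h
  simp only [map_sum, map_pow, aeval_X, map_mul, aeval_C, bernoulliPoly, map_prod, map_add,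
    Complex.coe_algebraMap, Complex.ofReal_natCast, Complex.ofReal_sub, Complex.ofReal_one] at h1
  rw [integral_ust, h1, Complex.real_smul]
  push_cast
  rw [inv_mul_cancel_left₀ hne]

end Law

/-- The natural number division is exact because `3 ^ m` is odd. -/
theorem labelMult_formulas (m : ℕ) : 2 * (((3 ^ m - 1) / 2 : ℕ) : ℝ) + 1 = 3 ^ m := by
  have h : Odd (3 ^ m) := Odd.pow (by decide)
  obtain ⟨k, hk⟩ := h
  have : 2 * ((3 ^ m - 1) / 2) + 1 = 3 ^ m := by omega
  exact_mod_cast this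

theorem meanCount_varCount_formulas (m : ℕ) :
    (meanCount (m + 1) EdgeLabel.a = (16 * 3 ^ (m + 1) + 7) / 30 ∧
     meanCount (m + 1) EdgeLabel.b = (16 * 3 ^ (m + 1) + 7) / 30 ∧
     meanCount (m + 1) EdgeLabel.c = (13 * 3 ^ (m + 1) + 1) / 30) ∧
    (varCount (m + 1) EdgeLabel.a = (199 * 3 ^ (m + 1) + 28) / 900 ∧
     varCount (m + 1) EdgeLabel.b = (199 * 3 ^ (m + 1) + 28) / 900 ∧
     varCount (m + 1) EdgeLabel.c = (34 * 3 ^ (m + 1) - 2) / 225) := by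
  have h := labelMult_formulas m
  simp only [meanCount_eq, varCount_eq, Fin.sum_univ_three, labelMult, labelParam,
    Matrix.cons_val, pow_succ, ← h]
  push_cast
  refine ⟨⟨?_, ?_, ?_⟩, ?_, ?_, ?_⟩ <;> ring

theorem tendsto_varCount (w : EdgeLabel) :
    Tendsto (fun m => varCount (m + 1) w) atTop atTop := by
  have h3 : Tendsto (fun m : ℕ => (3 : ℝ) ^ (m + 1)) atTop atTop :=
    (tendsto_pow_atTop_atTop_of_one_lt (by norm_num)).comp (tendsto_add_atTop_nat 1)
  -- The constant `1/10` lies below both leading coefficients `199/900` and `34/225`, with room for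
  -- the term `-2/225`.
  refine tendsto_atTop_mono (fun m => ?_) (h3.const_mul_atTop (r := 1 / 10) (by norm_num))
  obtain ⟨-, ha, hb, hc⟩ := meanCount_varCount_formulas m
  have : (1 : ℝ) ≤ 3 ^ (m + 1) := one_le_pow₀ (by norm_num)
  cases w
  · rw [ha]; linarith
  · rw [hb]; linarith
  · rw [hc]; linarith

theorem integral_cexp_normalizedCount (w : EdgeLabel) (m : ℕ) (z : ℂ) :
    ∫ t, Complex.exp (z * normalizedCount (m + 1) w t) ∂(ust (m + 1)) =
      Complex.exp (-(z / (√(varCount (m + 1) w) : ℝ)) *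
        (∑ i, labelMult w m i * labelParam w i : ℝ)) *
      ∏ i, (1 - (labelParam w i : ℂ) + labelParam w i *
        Complex.exp (z / (√(varCount (m + 1) w) : ℝ))) ^ labelMult w m i := by
  rw [← integral_pow_labelCount, ← integral_const_mul]
  congr 1
  funext t
  rw [← Complex.exp_nat_mul, ← Complex.exp_add, normalizedCount, meanCount_eq, labelCount]
  congr 1
  push_cast
  ring

/-- Allowing complex `z` serves both limits: `z = t` is the moment generating function, `z = t * I`
the characteristic function. -/
theorem tendsto_integral_cexp (w : EdgeLabel) (z : ℂ) :
    Tendsto (fun m => ∫ t, Complex.exp (z * normalizedCount (m + 1) w t) ∂(ust (m + 1))) atTop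
      (𝓝 (Complex.exp (z ^ 2 / 2))) := by
  simp only [integral_cexp_normalizedCount]
  exact tendsto_bernoulli_mgf (labelParam w) (labelParam_mem w) (labelMult w) _
    (varCount_eq w) (tendsto_varCount w) z

theorem tendsto_mgf_normalizedCount (w : EdgeLabel) (t : ℝ) :
    Tendsto (fun n : ℕ => mgf (normalizedCount n w) (ust n) t) atTop
      (𝓝 (Real.exp (t ^ 2 / 2))) := by
  rw [← tendsto_add_atTop_iff_nat 1]
  have h := (Complex.continuous_re.tendsto _).comp (tendsto_integral_cexp w t)
  have h1 : Complex.exp ((t : ℂ) ^ 2 / 2) = ((Real.exp (t ^ 2 / 2) : ℝ) : ℂ) := by push_cast; rfl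
  rw [h1, Complex.ofReal_re] at h
  refine h.congr fun m => ?_
  rw [Function.comp_apply, mgf, ← Complex.ofReal_re (∫ x, _ ∂_), ← integral_complex_ofReal]
  push_cast
  rfl

theorem tendsto_cdf_normalizedCount (w : EdgeLabel) (x : ℝ) :
    Tendsto (fun n : ℕ => (ust n).real {T | normalizedCount n w T ≤ x}) atTop
      (𝓝 ((gaussianReal 0 1).real (Set.Iic x))) := by
  rw [← tendsto_add_atTop_iff_nat 1]
  have hprob := isProbabilityMeasure_ust
  have hmeas : ∀ n, Measurable (normalizedCount n w) := fun n => Measurable.of_discrete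
  let ν : ℕ → ProbabilityMeasure ℝ := fun m =>
    ⟨(ust (m + 1)).map (normalizedCount (m + 1) w),
      Measure.isProbabilityMeasure_map (hmeas (m + 1)).aemeasurable⟩
  let γ : ProbabilityMeasure ℝ := ⟨gaussianReal 0 1, inferInstance⟩
  have hν : Tendsto ν atTop (𝓝 γ) := by
    rw [ProbabilityMeasure.tendsto_iff_tendsto_charFun]
    intro t
    change Tendsto (fun m => charFun ((ust (m + 1)).map (normalizedCount (m + 1) w)) t) atTop
      (𝓝 (charFun (gaussianReal 0 1) t))
    rw [charFun_gaussianReal]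
    convert tendsto_integral_cexp w (t * Complex.I) using 2 with m
    · rw [charFun_apply_real, integral_map (hmeas _).aemeasurable (by fun_prop)]
      congr 1
      funext T
      congr 1
      ring
    · congr 1
      rw [mul_pow, Complex.I_sq]
      simp
      ring
  -- The Gaussian has no atoms, so `Set.Iic x` is a continuity set and weak convergence passes to
  -- its probability.
  have hfr : γ (frontier (Set.Iic x)) = 0 := by
    rw [frontier_Iic, ProbabilityMeasure.null_iff_toMeasure_null]
    have := nullSingletonClass_gaussianReal (μ := 0) (v := 1) one_ne_zero
    exact measure_singleton (μ := gaussianReal 0 1) x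
  have h := ProbabilityMeasure.tendsto_measure_of_null_frontier_of_tendsto hν hfr
  have h' := (NNReal.continuous_coe.tendsto _).comp h
  refine h'.congr fun m => ?_
  change ((ust (m + 1)).map (normalizedCount (m + 1) w)).real (Set.Iic x) = _
  rw [map_measureReal_apply (hmeas _) measurableSet_Iic]
  rfl

end Sierpinski

theorem mainTheorem7 :
    (∀ n : ℕ, 1 ≤ n →
      (Sierpinski.meanCount n EdgeLabel.a = (16 * 3 ^ n + 7) / 30 ∧
       Sierpinski.meanCount n EdgeLabel.b = (16 * 3 ^ n + 7) / 30 ∧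
       Sierpinski.meanCount n EdgeLabel.c = (13 * 3 ^ n + 1) / 30) ∧
      (Sierpinski.varCount n EdgeLabel.a = (199 * 3 ^ n + 28) / 900 ∧
       Sierpinski.varCount n EdgeLabel.b = (199 * 3 ^ n + 28) / 900 ∧
       Sierpinski.varCount n EdgeLabel.c = (34 * 3 ^ n - 2) / 225)) ∧
    (∀ w : EdgeLabel,
      (∀ t : ℝ, Tendsto (fun n : ℕ => mgf (Sierpinski.normalizedCount n w) (Sierpinski.ust n) t)
        atTop (𝓝 (Real.exp (t ^ 2 / 2)))) ∧
      (∀ x : ℝ, Tendsto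
        (fun n : ℕ => (Sierpinski.ust n).real {T | Sierpinski.normalizedCount n w T ≤ x})
        atTop (𝓝 ((gaussianReal 0 1).real (Set.Iic x))))) := by
  refine ⟨fun n hn => ?_, fun w => ⟨Sierpinski.tendsto_mgf_normalizedCount w,
    Sierpinski.tendsto_cdf_normalizedCount w⟩⟩
  obtain ⟨m, rfl⟩ := Nat.exists_eq_add_of_le' hn
  exact Sierpinski.meanCount_varCount_formulas m
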